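/- A \emph{hyperbolic polygon} is a compact region of the hyperbolic plane $\mathbb{H}^2$ enclosed by a simple closed curve consisting of finitely many geodesic segments (its sides, whose endpoints are its vertices). A \emph{polygonal tiling} of $\mathbb{H}^2$ is a family of hyperbolic polygons (tiles) that covers $\mathbb{H}^2$, such that the tiles have pairwise disjoint interiors, any two different tiles are either disjoint or intersect exactly in a union of some common sides and common vertices, and every vertex is an endpoint of only finitely many sides (i.e. the graph formed by all vertices and sides of the tiles is locally finite). Let $\mathcal{T}$ be a polygonal tiling of $\mathbb{H}^2$, let $\Gamma$ be a group of isometries of $\mathbb{H}^2$ which preserves $\mathcal{T}$ and acts transitively on the set of vertices of $\mathcal{T}$, and let $\Gamma_{\mathrm{F}}\le\Gamma$ be the subgroup of all orientation preserving isometries in $\Gamma$. Then for any two closed halfplanes $H_1,H_2\subset\mathbb{H}^2$ (a closed halfplane being a closed side of a geodesic line) there exists $\gamma\in\Gamma_{\mathrm{F}}$ with $\gamma(H_1)\subseteq H_2$. -/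

import Mathlib

open UpperHalfPlane

namespace HypTiling

/-- The geodesic segment joining two points of the hyperbolic plane. -/
def geodSegment (x y : ℍ) : Set ℍ := {z | dist x z + dist z y = dist x y}

theorem image_geodSegment (g : ℍ ≃ᵢ ℍ) (x y : ℍ) :
    g '' geodSegment x y = geodSegment (g x) (g y) := by
  ext z
  constructor
  · rintro ⟨w, hw, rfl⟩
    simpa [geodSegment, g.dist_eq] using hw
  · intro hz
    refine ⟨g.symm z, ?_, by simp⟩
    have h1 : dist x (g.symm z) = dist (g x) z := by
      rw [← g.dist_eq, g.apply_symm_apply]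
    have h2 : dist (g.symm z) y = dist z (g y) := by
      rw [← g.dist_eq, g.apply_symm_apply]
    have hz' : dist (g x) z + dist z (g y) = dist (g x) (g y) := hz
    change dist x (g.symm z) + dist (g.symm z) y = dist x y
    rw [h1, h2, hz', g.dist_eq]

/-- The geodesic segments joining cyclically consecutive points of `v` form a simple closed
curve. A straight angle at a point `v i` is allowed. -/
structure IsSimpleClosed {n : ℕ} (v : ZMod n → ℍ) : Prop where
  injective : Function.Injective v
  consecutive : ∀ i, geodSegment (v i) (v (i + 1)) ∩ geodSegment (v (i + 1)) (v (i + 1 + 1))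
    = {v (i + 1)}
  nonconsecutive : ∀ i j, j ≠ i → j ≠ i + 1 → i ≠ j + 1 →
    Disjoint (geodSegment (v i) (v (i + 1))) (geodSegment (v j) (v (j + 1)))

/-- A (finite sided, compact, not necessarily convex) hyperbolic polygon: the compact region
enclosed by a simple closed curve made of `n ≥ 3` geodesic segments, together with the data of its
vertices and sides. -/
structure Polygon where
  carrier : Set ℍ
  vertices : Set ℍ
  sides : Set (Set ℍ)
  isCompact : IsCompact carrier
  closure_interior : closure (interior carrier) = carrier
  boundary : ∃ (n : ℕ) (v : ZMod n → ℍ), 3 ≤ n ∧ IsSimpleClosed v ∧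
    vertices = Set.range v ∧
    sides = Set.range (fun i => geodSegment (v i) (v (i + 1))) ∧
    frontier carrier = ⋃ i, geodSegment (v i) (v (i + 1))

/-- The image of a polygon under an isometry of the hyperbolic plane. -/
def Polygon.map (g : ℍ ≃ᵢ ℍ) (P : Polygon) : Polygon where
  carrier := g '' P.carrier
  vertices := g '' P.vertices
  sides := (fun s => g '' s) '' P.sides
  isCompact := P.isCompact.image g.continuous
  closure_interior := by
    have h := congrArg (fun s => g.toHomeomorph '' s) P.closure_interior
    simp only [Homeomorph.image_closure, Homeomorph.image_interior] at h
    exact h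
  boundary := by
    obtain ⟨n, v, hn, hv, hV, hS, hF⟩ := P.boundary
    refine ⟨n, fun i => g (v i), hn, ⟨g.injective.comp hv.injective, fun i => ?_,
      fun i j h1 h2 h3 => ?_⟩, ?_, ?_, ?_⟩
    · rw [← image_geodSegment, ← image_geodSegment, ← Set.image_inter g.injective,
        hv.consecutive, Set.image_singleton]
    · rw [← image_geodSegment, ← image_geodSegment]
      exact (Set.disjoint_image_iff g.injective).2 (hv.nonconsecutive i j h1 h2 h3)
    · rw [hV, ← Set.range_comp]
      rfl
    · rw [hS, ← Set.range_comp]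
      exact congrArg Set.range (funext fun i => image_geodSegment g _ _)
    · have h := congrArg (fun s => g.toHomeomorph '' s) hF
      simp only [Homeomorph.image_frontier, Set.image_iUnion] at h
      refine Eq.trans h (Set.iUnion_congr fun i => image_geodSegment g _ _)

/-- The vertices of the graph of a family of polygons. -/
def tilingVertices (𝒯 : Set Polygon) : Set ℍ := ⋃ T ∈ 𝒯, T.vertices

/-- The edges of the graph of a family of polygons, as geodesic segments. -/
def tilingEdges (𝒯 : Set Polygon) : Set (Set ℍ) := ⋃ T ∈ 𝒯, T.sides

/-- A polygonal tiling of the hyperbolic plane with locally finite graph. -/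
structure IsTiling (𝒯 : Set Polygon) : Prop where
  covers : ⋃ T ∈ 𝒯, T.carrier = Set.univ
  disjoint_interior : ∀ T ∈ 𝒯, ∀ T' ∈ 𝒯, T ≠ T' → Disjoint (interior T.carrier) (interior T'.carrier)
  /-- Two different tiles meet in a (possibly empty) union of common sides and vertices. -/
  inter_eq : ∀ T ∈ 𝒯, ∀ T' ∈ 𝒯, T ≠ T' →
    ∃ S ⊆ T.sides ∩ T'.sides, ∃ W ⊆ T.vertices ∩ T'.vertices,
      T.carrier ∩ T'.carrier = ⋃₀ S ∪ W
  /-- Every vertex of the graph has finite degree. -/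
  finite_degree : ∀ x ∈ tilingVertices 𝒯, {e ∈ tilingEdges 𝒯 | x ∈ e}.Finite

/-- `Γ` preserves the tiling `𝒯` and acts transitively on its vertices. -/
structure ActsVertexTransitively (Γ : Subgroup (ℍ ≃ᵢ ℍ)) (𝒯 : Set Polygon) : Prop where
  preserves : ∀ g ∈ Γ, ∀ T ∈ 𝒯, T.map g ∈ 𝒯
  transitive : ∀ x ∈ tilingVertices 𝒯, ∀ y ∈ tilingVertices 𝒯, ∃ g ∈ Γ, g x = y

/-- A self-map of the upper half-plane, read as a map between subsets of `ℂ`. -/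
noncomputable def inCoord (g : ℍ → ℍ) : ℂ → ℂ := fun w => (g (ofComplex w) : ℂ)

/-- An isometry preserves orientation if the determinant of its real differential is positive at
every point (in particular the differential exists: the junk value of `fderiv` has
determinant zero). -/
def OrientationPreserving (g : ℍ ≃ᵢ ℍ) : Prop :=
  ∀ z : ℍ, 0 < (fderiv ℝ (inCoord g) (z : ℂ)).det

theorem det_zero_clm : (0 : ℂ →L[ℝ] ℂ).det = 0 := by
  have h : (0 : ℂ →ₗ[ℝ] ℂ).det = 0 := by
    rw [LinearMap.det_zero]
    simp
  exact h

theorem OrientationPreserving.differentiableAt {g : ℍ ≃ᵢ ℍ} (hg : OrientationPreserving g)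
    (z : ℍ) : DifferentiableAt ℝ (inCoord g) (z : ℂ) := by
  by_contra h
  have := hg z
  rw [fderiv_zero_of_not_differentiableAt h, det_zero_clm] at this
  exact lt_irrefl _ this

theorem inCoord_coe (g : ℍ → ℍ) (z : ℍ) : inCoord g z = g z := by
  simp [inCoord]

theorem inCoord_comp (g h : ℍ → ℍ) : inCoord (g ∘ h) = inCoord g ∘ inCoord h := by
  funext w
  simp [inCoord]

theorem inCoord_id_eventuallyEq (z : ℍ) : inCoord id =ᶠ[nhds (z : ℂ)] id := by
  filter_upwards [isOpen_upperHalfPlaneSet.mem_nhds z.im_pos] with w hw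
  simp [inCoord, ofComplex_apply_of_im_pos hw]

theorem fderiv_inCoord_id (z : ℍ) :
    fderiv ℝ (inCoord id) (z : ℂ) = ContinuousLinearMap.id ℝ ℂ := by
  rw [(inCoord_id_eventuallyEq z).fderiv_eq, fderiv_id]

theorem det_comp_clm (A B : ℂ →L[ℝ] ℂ) : (A.comp B).det = A.det * B.det :=
  LinearMap.det_comp (A : ℂ →ₗ[ℝ] ℂ) (B : ℂ →ₗ[ℝ] ℂ)

theorem det_id_clm : (ContinuousLinearMap.id ℝ ℂ).det = 1 :=
  LinearMap.det_id

theorem OrientationPreserving.one : OrientationPreserving 1 := by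
  intro z
  change 0 < (fderiv ℝ (inCoord id) (z : ℂ)).det
  rw [fderiv_inCoord_id, det_id_clm]
  exact one_pos

theorem OrientationPreserving.mul {g h : ℍ ≃ᵢ ℍ} (hg : OrientationPreserving g)
    (hh : OrientationPreserving h) : OrientationPreserving (g * h) := by
  intro z
  change 0 < (fderiv ℝ (inCoord (g ∘ h)) (z : ℂ)).det
  have e : inCoord h (z : ℂ) = ((h z : ℍ) : ℂ) := inCoord_coe h z
  rw [inCoord_comp, fderiv_comp (z : ℂ) (e ▸ hg.differentiableAt (h z)) (hh.differentiableAt z),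
    e, det_comp_clm]
  exact mul_pos (hg _) (hh _)

theorem continuousAt_inCoord (g : ℍ ≃ᵢ ℍ) (z : ℍ) : ContinuousAt (inCoord g) (z : ℂ) := by
  have h1 : ContinuousAt (fun w : ℂ => ofComplex w) (z : ℂ) :=
    (contMDiffAt_ofComplex (n := 0) z.im_pos).continuousAt
  exact (continuous_coe.comp g.continuous).continuousAt.comp h1

theorem OrientationPreserving.inv {g : ℍ ≃ᵢ ℍ} (hg : OrientationPreserving g) :
    OrientationPreserving g⁻¹ := by
  intro z
  have e : inCoord (g⁻¹ : ℍ ≃ᵢ ℍ) (z : ℂ) = ((g⁻¹ z : ℍ) : ℂ) := inCoord_coe _ z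
  have hd := hg (g⁻¹ z)
  have hD := (hg.differentiableAt (g⁻¹ z)).hasFDerivAt
  set A := fderiv ℝ (inCoord g) ((g⁻¹ z : ℍ) : ℂ) with hA
  have hne : A.det ≠ 0 := hd.ne'
  have hcoe : ((A.toContinuousLinearEquivOfDetNeZero hne : ℂ ≃L[ℝ] ℂ) : ℂ →L[ℝ] ℂ) = A := by
    ext <;> simp
  have hD' : HasFDerivAt (inCoord g)
      ((A.toContinuousLinearEquivOfDetNeZero hne : ℂ ≃L[ℝ] ℂ) : ℂ →L[ℝ] ℂ)
      (inCoord (g⁻¹ : ℍ ≃ᵢ ℍ) (z : ℂ)) := by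
    rw [hcoe, e]
    exact hD
  have hcomp : (g : ℍ → ℍ) ∘ (g⁻¹ : ℍ ≃ᵢ ℍ) = id := by
    funext w
    exact g.apply_symm_apply w
  have hinv : ∀ᶠ w in nhds (z : ℂ), inCoord g (inCoord (g⁻¹ : ℍ ≃ᵢ ℍ) w) = w := by
    filter_upwards [inCoord_id_eventuallyEq z] with w hw
    have := congrFun (inCoord_comp g (g⁻¹ : ℍ ≃ᵢ ℍ)) w
    rw [hcomp, hw] at this
    exact this.symm
  have hB := HasFDerivAt.of_local_left_inverse (continuousAt_inCoord g⁻¹ z) hD' hinv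
  have hprod : fderiv ℝ (inCoord (g ∘ (g⁻¹ : ℍ ≃ᵢ ℍ))) (z : ℂ)
      = A.comp (fderiv ℝ (inCoord (g⁻¹ : ℍ ≃ᵢ ℍ)) (z : ℂ)) := by
    rw [inCoord_comp, fderiv_comp (z : ℂ) hD'.differentiableAt hB.differentiableAt, e]
  rw [hcomp, fderiv_inCoord_id] at hprod
  have hdet := congrArg ContinuousLinearMap.det hprod
  rw [det_id_clm, det_comp_clm] at hdet
  by_contra hneg
  have := mul_nonpos_of_nonneg_of_nonpos hd.le (not_lt.1 hneg)
  linarith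

/-- The subgroup of all orientation preserving isometries in `Γ`. -/
def orientationPreservingSubgroup (Γ : Subgroup (ℍ ≃ᵢ ℍ)) : Subgroup (ℍ ≃ᵢ ℍ) where
  carrier := {g | g ∈ Γ ∧ OrientationPreserving g}
  mul_mem' := fun ha hb => ⟨Γ.mul_mem ha.1 hb.1, ha.2.mul hb.2⟩
  one_mem' := ⟨Γ.one_mem, OrientationPreserving.one⟩
  inv_mem' := fun ha => ⟨Γ.inv_mem ha.1, ha.2.inv⟩

/-- A closed halfplane, i.e. a closed side of a geodesic line. The geodesic lines of the upper
half-plane are the loci `a|z|² + b Re z + c = 0` with `b² - 4ac > 0`: the vertical lines (`a = 0`)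
and the half-circles centred on the real axis (`a ≠ 0`). -/
def IsHalfplane (H : Set ℍ) : Prop :=
  ∃ a b c : ℝ, 0 < b ^ 2 - 4 * a * c ∧
    H = {z : ℍ | 0 ≤ a * Complex.normSq (z : ℂ) + b * z.re + c}

end HypTiling

/-!
The orbit of a vertex under `orientationPreservingSubgroup Γ` is cobounded and discrete: only
finitely many tiles share an edge, hence a vertex, so the tiles fall into finitely many classes
modulo `Γ`, which bounds their diameters from above and their inradii from below.

In the hyperboloid model isometries act linearly, and a halfplane consists of the points on which a
spacelike vector `n` is nonnegative. Let `n₁`, `n₂` define `H₁`, `H₂`. By coboundedness there are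
`γ k` moving a base point deeper and deeper into `H₂`; suitable multiples of `(γ k)⁻¹ n₂` then
converge to a lightlike vector `v`, that is, the complement of `(γ k)⁻¹ H₂` shrinks to a boundary
point. A cobounded and discrete group fixes no boundary point, and so some `g` in the group moves
this boundary point off the closure of `H₁`. For large `k`, `g (γ k)⁻¹ n₂` is then positive on
`H₁`, and `γ k * g⁻¹` maps `H₁` into `H₂`.
-/

namespace HypTiling

open Filter Topology

section MinkowskiSpace

/-- The Lorentzian vector space in which the hyperbolic plane sits as a hyperboloid. The vector
`(a, b, c)` is read as the binary quadratic form `a X² + b X Y + c Y²`. -/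
abbrev MinkowskiSpace : Type := ℝ × ℝ × ℝ

/-- The Lorentzian form of signature `(1, 2)` on `MinkowskiSpace`, the polarization of
`4 a c - b ^ 2`. A vector is timelike, lightlike or spacelike if its square is positive, zero or
negative. -/
noncomputable def minkowski : LinearMap.BilinForm ℝ MinkowskiSpace :=
  LinearMap.mk₂ ℝ (fun v w => 2 * v.1 * w.2.2 + 2 * w.1 * v.2.2 - v.2.1 * w.2.1)
    (fun _ _ _ => by simp only [Prod.fst_add, Prod.snd_add]; ring)
    (fun _ _ _ => by simp only [Prod.smul_fst, Prod.smul_snd, smul_eq_mul]; ring)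
    (fun _ _ _ => by simp only [Prod.fst_add, Prod.snd_add]; ring)
    (fun _ _ _ => by simp only [Prod.smul_fst, Prod.smul_snd, smul_eq_mul]; ring)

/-- The point of the hyperboloid corresponding to a point of the upper half-plane; `z` is the root
of the associated quadratic form. -/
noncomputable def toHyperboloid (z : ℍ) : MinkowskiSpace :=
  (1 / (2 * z.im), -z.re / z.im, (z.re ^ 2 + z.im ^ 2) / (2 * z.im))

variable {v w n : MinkowskiSpace}

theorem minkowski_apply (v w : MinkowskiSpace) :
    minkowski v w = 2 * v.1 * w.2.2 + 2 * w.1 * v.2.2 - v.2.1 * w.2.1 := rfl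

theorem minkowski_comm (v w : MinkowskiSpace) : minkowski v w = minkowski w v := by
  simp only [minkowski_apply]; ring

theorem minkowski_add_self (v w : MinkowskiSpace) :
    minkowski (v + w) (v + w) = minkowski v v + 2 * minkowski v w + minkowski w w := by
  simp only [map_add, LinearMap.add_apply, minkowski_comm w v]; ring

theorem minkowski_smul_self (c : ℝ) (v : MinkowskiSpace) :
    minkowski (c • v) (c • v) = c ^ 2 * minkowski v v := by
  simp only [map_smul, LinearMap.smul_apply, smul_eq_mul]; ring

theorem continuous_minkowski_self : Continuous fun v : MinkowskiSpace => minkowski v v := by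
  simp only [minkowski_apply]; fun_prop

theorem continuous_minkowski_left (w : MinkowskiSpace) : Continuous fun v => minkowski v w := by
  simp only [minkowski_apply]; fun_prop

theorem minkowski_toHyperboloid (v : MinkowskiSpace) (z : ℍ) :
    minkowski v (toHyperboloid z) =
      (v.1 * (z.re ^ 2 + z.im ^ 2) + v.2.1 * z.re + v.2.2) / z.im := by
  have := z.im_ne_zero
  simp only [minkowski_apply, toHyperboloid]
  field_simp
  ring

theorem minkowski_toHyperboloid_toHyperboloid (z w : ℍ) :
    minkowski (toHyperboloid z) (toHyperboloid w) = Real.cosh (dist z w) := by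
  have := z.im_ne_zero
  have := w.im_ne_zero
  rw [cosh_dist', minkowski_toHyperboloid]
  simp only [toHyperboloid]
  field_simp
  ring

theorem eq_of_forall_minkowski_toHyperboloid_eq
    (h : ∀ z, minkowski v (toHyperboloid z) = minkowski w (toHyperboloid z)) : v = w := by
  have h₀ := h ⟨⟨0, 1⟩, one_pos⟩
  have h₁ := h ⟨⟨0, 2⟩, two_pos⟩
  have h₂ := h ⟨⟨1, 1⟩, one_pos⟩
  simp only [minkowski_toHyperboloid, mk_re, mk_im, zero_pow two_ne_zero, one_pow, zero_add,
    mul_one, mul_zero, add_zero, div_one] at h₀ h₁ h₂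
  ext
  · linarith
  · linarith
  · linarith

theorem minkowski_self_eq (v : MinkowskiSpace) (z : ℍ) :
    minkowski v v = minkowski v (toHyperboloid z) ^ 2 - (v.2.1 + 2 * v.1 * z.re) ^ 2 -
      (2 * v.1 * z.im - minkowski v (toHyperboloid z)) ^ 2 := by
  have := z.im_ne_zero
  rw [minkowski_toHyperboloid, minkowski_apply]
  field_simp
  ring

theorem eq_zero_of_minkowski_toHyperboloid_eq_zero {z : ℍ}
    (hz : minkowski v (toHyperboloid z) = 0) (hv : 0 ≤ minkowski v v) : v = 0 := by
  have key := minkowski_self_eq v z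
  rw [hz] at key
  have ha : v.1 = 0 := by
    have : 2 * v.1 * z.im = 0 := by nlinarith [sq_nonneg (v.2.1 + 2 * v.1 * z.re)]
    simpa [z.im_ne_zero] using this
  have hb : v.2.1 = 0 := by
    rw [ha] at key
    nlinarith
  have hc : v.2.2 = 0 := by
    simpa [minkowski_toHyperboloid, ha, hb, z.im_ne_zero] using hz
  ext <;> assumption

theorem minkowski_toHyperboloid_pos {p : ℍ} (hv : 0 ≤ minkowski v v)
    (hp : 0 < minkowski v (toHyperboloid p)) (z : ℍ) : 0 < minkowski v (toHyperboloid z) := by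
  have hv₀ : v ≠ 0 := by rintro rfl; simp at hp
  by_contra! hz
  obtain ⟨q, hq⟩ : ∃ q, minkowski v (toHyperboloid q) = 0 := by
    refine mem_range_of_exists_le_of_exists_ge ?_ ⟨z, hz⟩ ⟨p, hp.le⟩
    simp only [minkowski_toHyperboloid]
    exact Continuous.div (by fun_prop) (by fun_prop) fun q => q.im_ne_zero
  exact hv₀ (eq_zero_of_minkowski_toHyperboloid_eq_zero hq hv)

/-- This is the equality case of the reversed Cauchy–Schwarz inequality. -/
theorem exists_eq_smul_of_minkowski_nonpos {z : ℍ} (hv : 0 ≤ minkowski v v)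
    (hw : 0 ≤ minkowski w w) (hvz : 0 < minkowski v (toHyperboloid z))
    (hwz : 0 < minkowski w (toHyperboloid z)) (hvw : minkowski v w ≤ 0) : ∃ c : ℝ, w = c • v := by
  set c := minkowski w (toHyperboloid z) / minkowski v (toHyperboloid z) with hc
  have : 0 < c := div_pos hwz hvz
  refine ⟨c, sub_eq_zero.1 (eq_zero_of_minkowski_toHyperboloid_eq_zero (z := z) ?_ ?_)⟩
  · simp [hc, hvz.ne']
  · calc (0 : ℝ) ≤ minkowski w w + 2 * c * -minkowski v w + c ^ 2 * minkowski v v := by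
          have := neg_nonneg.2 hvw
          positivity
      _ = minkowski (w - c • v) (w - c • v) := by
          simp only [map_sub, map_smul, LinearMap.sub_apply, LinearMap.smul_apply, smul_eq_mul,
            minkowski_comm w v]
          ring

theorem exists_eq_smul_toHyperboloid {z : ℍ} (hv : 0 < minkowski v v)
    (hvz : 0 < minkowski v (toHyperboloid z)) : ∃ c : ℝ, 0 < c ∧ ∃ p, v = c • toHyperboloid p := by
  obtain ⟨a, b, c⟩ := v
  simp only [minkowski_apply] at hv
  rw [minkowski_toHyperboloid, div_pos_iff_of_pos_right z.im_pos] at hvz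
  have ha : 0 < a := by
    by_contra! ha
    nlinarith [sq_nonneg (2 * a * z.re + b), sq_nonneg (a * z.im)]
  set r := √(4 * a * c - b ^ 2)
  have hr_pos : 0 < r := Real.sqrt_pos.2 (by linarith)
  have hr_sq : r ^ 2 = 4 * a * c - b ^ 2 := Real.sq_sqrt (by linarith)
  refine ⟨r, hr_pos, ⟨⟨-b / (2 * a), r / (2 * a)⟩, div_pos hr_pos (by positivity)⟩, ?_⟩
  simp only [toHyperboloid, Prod.smul_mk, smul_eq_mul, Prod.mk.injEq, UpperHalfPlane.re,
    UpperHalfPlane.im]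
  refine ⟨by field_simp, by field_simp, ?_⟩
  field_simp
  linarith

theorem isBounded_setOf_minkowski_toHyperboloid_eq_one (z : ℍ) (D : ℝ) :
    Bornology.IsBounded {v | minkowski v (toHyperboloid z) = 1 ∧ D ≤ minkowski v v} := by
  set K := Set.Icc (-√(1 - D)) √(1 - D)
  let a : ℝ × ℝ → ℝ := fun p => (p.2 + 1) / (2 * z.im)
  let b : ℝ × ℝ → ℝ := fun p => p.1 - 2 * a p * z.re
  let f : ℝ × ℝ → MinkowskiSpace := fun p =>
    (a p, b p, z.im - a p * (z.re ^ 2 + z.im ^ 2) - b p * z.re)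
  have hf : Continuous f := by fun_prop
  refine ((isCompact_Icc.prod isCompact_Icc).image hf).isBounded.subset (t := f '' (K ×ˢ K)) ?_
  rintro v ⟨hv, hD⟩
  have hz := z.im_ne_zero
  have key := minkowski_self_eq v z
  rw [hv] at key
  refine ⟨(v.2.1 + 2 * v.1 * z.re, 2 * v.1 * z.im - 1), ⟨?_, ?_⟩, ?_⟩
  · refine abs_le.1 (Real.abs_le_sqrt ?_)
    nlinarith [sq_nonneg (2 * v.1 * z.im - 1)]
  · refine abs_le.1 (Real.abs_le_sqrt ?_)
    nlinarith [sq_nonneg (v.2.1 + 2 * v.1 * z.re)]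
  · rw [minkowski_toHyperboloid, div_eq_one_iff_eq hz] at hv
    have ha : a (v.2.1 + 2 * v.1 * z.re, 2 * v.1 * z.im - 1) = v.1 := by
      simp only [a]; field_simp; ring
    have hb : b (v.2.1 + 2 * v.1 * z.re, 2 * v.1 * z.im - 1) = v.2.1 := by
      simp only [b, ha]; ring
    refine Prod.ext ha (Prod.ext hb ?_)
    simp only [f, ha, hb]
    linarith

theorem exists_quadratic_neg_of_minkowski_self_neg (hn : minkowski n n < 0) :
    ∃ s : ℝ, n.1 * s ^ 2 + n.2.1 * s + n.2.2 < 0 := by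
  by_contra! h
  have hdiscrim : discrim n.1 n.2.1 n.2.2 ≤ 0 :=
    discrim_le_zero fun s => by linarith [h s, sq s, congrArg (n.1 * ·) (sq s)]
  rw [discrim] at hdiscrim
  rw [minkowski_apply] at hn
  linarith

theorem tendsto_minkowski_toHyperboloid_atBot {ι : Type*} {l : Filter ι} {u : ι → ℍ} {s : ℝ}
    (hu : Tendsto (fun k => (u k : ℂ)) l (𝓝 s)) (hs : n.1 * s ^ 2 + n.2.1 * s + n.2.2 < 0) :
    Tendsto (fun k => minkowski n (toHyperboloid (u k))) l atBot := by
  have hre : Tendsto (fun k => (u k).re) l (𝓝 s) := (Complex.continuous_re.tendsto _).comp hu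
  have him : Tendsto (fun k => (u k).im) l (𝓝 0) := (Complex.continuous_im.tendsto _).comp hu
  have him_inv : Tendsto (fun k => (u k).im⁻¹) l atTop :=
    tendsto_inv_nhdsGT_zero.comp
      (tendsto_nhdsWithin_iff.2 ⟨him, .of_forall fun k => (u k).im_pos⟩)
  simp only [minkowski_toHyperboloid, div_eq_mul_inv]
  refine Tendsto.neg_mul_atTop hs ?_ him_inv
  simpa using (((hre.pow 2).add (him.pow 2)).const_mul n.1).add (hre.const_mul n.2.1)
    |>.add_const n.2.2

theorem eventually_forall_minkowski_toHyperboloid_pos {z : ℍ} (hv : 0 ≤ minkowski v v)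
    (hvz : 0 < minkowski v (toHyperboloid z)) (hvn : minkowski v n < 0) :
    ∀ᶠ m in 𝓝 v, ∀ p, 0 ≤ minkowski n (toHyperboloid p) → 0 < minkowski m (toHyperboloid p) := by
  have hc : ∀ᶠ c : ℝ in 𝓝[>] 0, 0 < c ∧ 0 < minkowski (v - c • n) (toHyperboloid z) ∧
      0 < -2 * minkowski v n + c * minkowski n n := by
    refine eventually_mem_nhdsWithin.and (nhdsWithin_le_nhds (Filter.Eventually.and ?_ ?_))
    · have : Continuous fun c : ℝ => minkowski (v - c • n) (toHyperboloid z) :=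
        (continuous_minkowski_left _).comp (by fun_prop)
      exact continuousAt_const.eventually_lt this.continuousAt (by simpa using hvz)
    · exact continuousAt_const.eventually_lt (by fun_prop) (by linarith)
  obtain ⟨c, hc₀, hcz, hcn⟩ := hc.exists
  have hc_self : 0 < minkowski (v - c • n) (v - c • n) := by
    calc (0 : ℝ) < minkowski v v + c * (-2 * minkowski v n + c * minkowski n n) := by positivity
      _ = minkowski (v - c • n) (v - c • n) := by
        simp only [map_sub, map_smul, LinearMap.sub_apply, LinearMap.smul_apply, smul_eq_mul,
          minkowski_comm n v]
        ring
  have h₁ : Continuous fun m => minkowski (m - c • n) (m - c • n) :=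
    continuous_minkowski_self.comp (continuous_id.sub continuous_const)
  have h₂ : Continuous fun m => minkowski (m - c • n) (toHyperboloid z) :=
    (continuous_minkowski_left _).comp (continuous_id.sub continuous_const)
  filter_upwards [h₁.continuousAt.eventually_const_lt hc_self,
    h₂.continuousAt.eventually_const_lt hcz] with m hm hmz p hp
  have hpos := minkowski_toHyperboloid_pos hm.le hmz p
  simp only [map_sub, map_smul, LinearMap.sub_apply, LinearMap.smul_apply, smul_eq_mul] at hpos
  linarith [mul_nonneg hc₀.le hp]

theorem IsHalfplane.exists_eq_setOf_minkowski_nonneg {H : Set ℍ} (hH : IsHalfplane H) :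
    ∃ n, minkowski n n < 0 ∧ H = {z | 0 ≤ minkowski n (toHyperboloid z)} := by
  obtain ⟨a, b, c, hdiscrim, rfl⟩ := hH
  refine ⟨(a, b, c), by rw [minkowski_apply]; linarith, Set.ext fun z => ?_⟩
  rw [Set.mem_ofPred_eq, Set.mem_ofPred_eq, minkowski_toHyperboloid, le_div_iff₀ z.im_pos,
    zero_mul, Complex.normSq_apply, ← sq, ← sq]
  rfl

end MinkowskiSpace

section Lorentz

/-- The images on the hyperboloid of the points `i`, `2 i` and `1 + i`, as a basis. -/
noncomputable def hyperboloidBasis : Module.Basis (Fin 3) ℝ MinkowskiSpace :=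
  basisOfLinearIndependentOfCardEqFinrank
    (b := ![toHyperboloid ⟨⟨0, 1⟩, one_pos⟩, toHyperboloid ⟨⟨0, 2⟩, two_pos⟩,
      toHyperboloid ⟨⟨1, 1⟩, one_pos⟩])
    (by
      refine Fintype.linearIndependent_iff.2 fun c hc => ?_
      simp only [Fin.sum_univ_three, Matrix.cons_val, toHyperboloid, mk_re, mk_im, Prod.smul_mk,
        smul_eq_mul, Prod.mk_add_mk, Prod.mk_eq_zero] at hc
      obtain ⟨h₁, h₂, h₃⟩ := hc
      exact fun
        | 0 => by linarith
        | 1 => by linarith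
        | 2 => by linarith)
    (by simp)

theorem exists_toHyperboloid_eq_hyperboloidBasis (i : Fin 3) :
    ∃ z, toHyperboloid z = hyperboloidBasis i := by
  rw [hyperboloidBasis, coe_basisOfLinearIndependentOfCardEqFinrank]
  fin_cases i <;> exact ⟨_, rfl⟩

/-- The linear map by which an isometry of the hyperbolic plane acts on the hyperboloid. -/
noncomputable def lorentzMap (g : ℍ ≃ᵢ ℍ) : MinkowskiSpace →ₗ[ℝ] MinkowskiSpace :=
  hyperboloidBasis.constr ℝ fun i =>
    toHyperboloid (g (exists_toHyperboloid_eq_hyperboloidBasis i).choose)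

theorem linearMap_ext_toHyperboloid {M : Type*} [AddCommGroup M] [Module ℝ M]
    {f₁ f₂ : MinkowskiSpace →ₗ[ℝ] M} (h : ∀ z, f₁ (toHyperboloid z) = f₂ (toHyperboloid z)) :
    f₁ = f₂ :=
  hyperboloidBasis.ext fun i => by
    obtain ⟨z, hz⟩ := exists_toHyperboloid_eq_hyperboloidBasis i
    rw [← hz, h]

theorem minkowski_lorentzMap_toHyperboloid (g : ℍ ≃ᵢ ℍ) (v : MinkowskiSpace) (z : ℍ) :
    minkowski (lorentzMap g v) (toHyperboloid (g z)) = minkowski v (toHyperboloid z) := by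
  suffices minkowski (toHyperboloid (g z)) ∘ₗ lorentzMap g = minkowski (toHyperboloid z) by
    rw [minkowski_comm _ (toHyperboloid _), minkowski_comm v]
    exact LinearMap.congr_fun this v
  refine hyperboloidBasis.ext fun i => ?_
  have hi := (exists_toHyperboloid_eq_hyperboloidBasis i).choose_spec
  rw [LinearMap.comp_apply, lorentzMap, Module.Basis.constr_basis,
    minkowski_toHyperboloid_toHyperboloid, g.dist_eq, ← minkowski_toHyperboloid_toHyperboloid, hi]

theorem lorentzMap_toHyperboloid (g : ℍ ≃ᵢ ℍ) (z : ℍ) :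
    lorentzMap g (toHyperboloid z) = toHyperboloid (g z) := by
  refine eq_of_forall_minkowski_toHyperboloid_eq fun w => ?_
  obtain ⟨w, rfl⟩ := g.surjective w
  simp only [minkowski_lorentzMap_toHyperboloid, minkowski_toHyperboloid_toHyperboloid, g.dist_eq]

theorem lorentzMap_mul (g h : ℍ ≃ᵢ ℍ) : lorentzMap (g * h) = lorentzMap g ∘ₗ lorentzMap h :=
  linearMap_ext_toHyperboloid fun z => by
    simp only [LinearMap.comp_apply, lorentzMap_toHyperboloid, IsometryEquiv.mul_apply]

theorem minkowski_lorentzMap_lorentzMap (g : ℍ ≃ᵢ ℍ) (v w : MinkowskiSpace) :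
    minkowski (lorentzMap g v) (lorentzMap g w) = minkowski v w := by
  suffices minkowski (lorentzMap g v) ∘ₗ lorentzMap g = minkowski v from
    LinearMap.congr_fun this w
  exact linearMap_ext_toHyperboloid fun z => by
    rw [LinearMap.comp_apply, lorentzMap_toHyperboloid, minkowski_lorentzMap_toHyperboloid]

theorem lorentzMap_surjective (g : ℍ ≃ᵢ ℍ) : Function.Surjective (lorentzMap g) := fun v =>
  ⟨lorentzMap g⁻¹ v, eq_of_forall_minkowski_toHyperboloid_eq fun z => by
    obtain ⟨z, rfl⟩ := g.surjective z
    rw [minkowski_lorentzMap_toHyperboloid, ← minkowski_lorentzMap_toHyperboloid g⁻¹ v (g z),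
      IsometryEquiv.inv_apply_self]⟩

end Lorentz

section Orientation

theorem coe_eq_div_toHyperboloid (z : ℍ) :
    (z : ℂ) = (-((toHyperboloid z).2.1 : ℂ) + Complex.I) / (2 * (toHyperboloid z).1) := by
  have hz : (z.im : ℂ) ≠ 0 := Complex.ofReal_ne_zero.2 z.im_ne_zero
  rw [← Complex.re_add_im (z : ℂ)]
  simp only [toHyperboloid, coe_re, coe_im, Complex.ofReal_div, Complex.ofReal_neg,
    Complex.ofReal_mul, Complex.ofReal_one, Complex.ofReal_ofNat]
  field_simp

theorem contDiffAt_inCoord (g : ℍ ≃ᵢ ℍ) (z : ℍ) : ContDiffAt ℝ 1 (inCoord g) (z : ℂ) := by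
  let X : ℂ → MinkowskiSpace := fun w =>
    (1 / (2 * w.im), -w.re / w.im, (w.re ^ 2 + w.im ^ 2) / (2 * w.im))
  let L := LinearMap.toContinuousLinearMap (lorentzMap g)
  have hLX (w : ℍ) : L (X w) = toHyperboloid (g w) := lorentzMap_toHyperboloid g w
  have heq : inCoord g =ᶠ[nhds (z : ℂ)]
      fun w => (-((L (X w)).2.1 : ℂ) + Complex.I) / (2 * (L (X w)).1) := by
    filter_upwards [isOpen_upperHalfPlaneSet.mem_nhds z.im_pos] with w hw
    lift w to ℍ using hw
    rw [inCoord_coe, hLX, ← coe_eq_div_toHyperboloid]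
  have hX : ContDiffAt ℝ 1 X z := by
    have hz : (z : ℂ).im ≠ 0 := z.im_ne_zero
    have hre : ContDiffAt ℝ 1 Complex.re z := Complex.reCLM.contDiff.contDiffAt
    have him : ContDiffAt ℝ 1 Complex.im z := Complex.imCLM.contDiff.contDiffAt
    fun_prop (disch := simpa using hz)
  have hLX' : ContDiffAt ℝ 1 (fun w => L (X w)) z := L.contDiff.contDiffAt.comp _ hX
  have ha : ContDiffAt ℝ 1 (fun w => ((L (X w)).1 : ℂ)) z :=
    Complex.ofRealCLM.contDiff.contDiffAt.comp _ hLX'.fst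
  have hb : ContDiffAt ℝ 1 (fun w => ((L (X w)).2.1 : ℂ)) z :=
    Complex.ofRealCLM.contDiff.contDiffAt.comp _ hLX'.snd.fst
  refine ContDiffAt.congr_of_eventuallyEq ?_ heq
  simp only [div_eq_mul_inv]
  refine (hb.neg.add contDiffAt_const).mul ((contDiffAt_const.mul ha).inv ?_)
  rw [hLX]
  simpa [toHyperboloid] using (g z).im_ne_zero

theorem det_fderiv_inCoord_mul (g h : ℍ ≃ᵢ ℍ) (z : ℍ) :
    (fderiv ℝ (inCoord (g * h : ℍ ≃ᵢ ℍ)) (z : ℂ)).det =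
      (fderiv ℝ (inCoord g) (h z : ℂ)).det * (fderiv ℝ (inCoord h) (z : ℂ)).det := by
  have hhz : inCoord h (z : ℂ) = (h z : ℂ) := inCoord_coe h z
  have hg : DifferentiableAt ℝ (inCoord g) (inCoord h z) :=
    hhz ▸ (contDiffAt_inCoord g (h z)).differentiableAt one_ne_zero
  have hh : DifferentiableAt ℝ (inCoord h) z :=
    (contDiffAt_inCoord h z).differentiableAt one_ne_zero
  change (fderiv ℝ (inCoord (g ∘ h)) (z : ℂ)).det = _
  rw [inCoord_comp, fderiv_comp _ hg hh, hhz, det_comp_clm]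

theorem det_fderiv_inCoord_ne_zero (g : ℍ ≃ᵢ ℍ) (z : ℍ) :
    (fderiv ℝ (inCoord g) (z : ℂ)).det ≠ 0 := by
  refine right_ne_zero_of_mul (a := (fderiv ℝ (inCoord (g⁻¹ : ℍ ≃ᵢ ℍ)) (g z : ℂ)).det) ?_
  rw [← det_fderiv_inCoord_mul, inv_mul_cancel]
  exact (OrientationPreserving.one z).ne'

theorem continuous_det_fderiv_inCoord (g : ℍ ≃ᵢ ℍ) :
    Continuous fun z : ℍ => (fderiv ℝ (inCoord g) (z : ℂ)).det := by
  refine ContinuousLinearMap.continuous_det.comp (continuous_iff_continuousAt.2 fun z => ?_)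
  exact ((contDiffAt_inCoord g z).continuousAt_fderiv one_ne_zero).comp
    continuous_coe.continuousAt

theorem orientationPreserving_or_forall_det_neg (g : ℍ ≃ᵢ ℍ) :
    OrientationPreserving g ∨ ∀ z : ℍ, (fderiv ℝ (inCoord g) (z : ℂ)).det < 0 := by
  by_contra! h
  obtain ⟨hnot, w, hw⟩ := h
  obtain ⟨z, hz⟩ := not_forall.1 hnot
  obtain ⟨u, hu⟩ := mem_range_of_exists_le_of_exists_ge (continuous_det_fderiv_inCoord g)
    ⟨z, not_lt.1 hz⟩ ⟨w, hw⟩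
  exact det_fderiv_inCoord_ne_zero g u hu

theorem OrientationPreserving.mul_of_not {g h : ℍ ≃ᵢ ℍ} (hg : ¬OrientationPreserving g)
    (hh : ¬OrientationPreserving h) : OrientationPreserving (g * h) := fun z => by
  rw [det_fderiv_inCoord_mul]
  exact mul_pos_of_neg_of_neg ((orientationPreserving_or_forall_det_neg g).resolve_left hg _)
    ((orientationPreserving_or_forall_det_neg h).resolve_left hh z)

theorem exists_mul_mem_orientationPreservingSubgroup (Γ : Subgroup (ℍ ≃ᵢ ℍ)) :
    ∃ s : ℍ ≃ᵢ ℍ, ∀ g ∈ Γ, g ∈ orientationPreservingSubgroup Γ ∨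
      g * s ∈ orientationPreservingSubgroup Γ := by
  by_cases h : ∃ s ∈ Γ, ¬OrientationPreserving s
  · obtain ⟨s, hs, hs'⟩ := h
    refine ⟨s, fun g hg => ?_⟩
    by_cases hg' : OrientationPreserving g
    · exact Or.inl ⟨hg, hg'⟩
    · exact Or.inr ⟨Γ.mul_mem hg hs, .mul_of_not hg' hs'⟩
  · push Not at h
    exact ⟨1, fun g hg => Or.inl ⟨hg, h g hg⟩⟩

end Orientation

section Orbits

/-- The orbit of `x` under `G` is coarsely dense. -/
def CoboundedOrbit {X : Type*} [PseudoMetricSpace X] (G : Subgroup (X ≃ᵢ X)) (x : X) : Prop :=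
  ∃ R : ℝ, ∀ z, ∃ g ∈ G, dist (g x) z ≤ R

/-- Only finitely many points of the orbit of `x` under `G` lie in any ball around `x`. The
stabilizer of `x` may be infinite. -/
def DiscreteOrbit {X : Type*} [PseudoMetricSpace X] (G : Subgroup (X ≃ᵢ X)) (x : X) : Prop :=
  ∀ r : ℝ, ({y | ∃ g ∈ G, g x = y} ∩ Metric.closedBall x r).Finite

theorem DiscreteOrbit.mono {X : Type*} [PseudoMetricSpace X] {G G' : Subgroup (X ≃ᵢ X)} {x : X}
    (h : DiscreteOrbit G x) (hG : G' ≤ G) : DiscreteOrbit G' x := fun r =>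
  (h r).subset (Set.inter_subset_inter_left _ fun _ ⟨g, hg, hgx⟩ => ⟨g, hG hg, hgx⟩)

theorem CoboundedOrbit.of_point {X : Type*} [PseudoMetricSpace X] {G : Subgroup (X ≃ᵢ X)} {x : X}
    (h : CoboundedOrbit G x) (y : X) : CoboundedOrbit G y := by
  obtain ⟨R, hR⟩ := h
  refine ⟨dist y x + R, fun z => ?_⟩
  obtain ⟨g, hg, hgz⟩ := hR z
  refine ⟨g, hg, (dist_triangle _ (g x) _).trans ?_⟩
  rw [g.dist_eq]
  gcongr

variable {G : Subgroup (ℍ ≃ᵢ ℍ)} {x : ℍ}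

theorem CoboundedOrbit.exists_tendsto_coe (h : CoboundedOrbit G x) (s : ℝ) :
    ∃ γ : ℕ → ℍ ≃ᵢ ℍ, (∀ k, γ k ∈ G) ∧ Tendsto (fun k => (γ k x : ℂ)) atTop (𝓝 s) := by
  obtain ⟨R, hR⟩ := h
  let z : ℕ → ℍ := fun k => ⟨⟨s, 1 / (k + 1)⟩, Nat.one_div_pos_of_nat⟩
  choose γ hγ hdist using fun k => hR (z k)
  have hz_im : Tendsto (fun k => (z k).im) atTop (𝓝 0) := tendsto_one_div_add_atTop_nhds_zero_nat
  have hz : Tendsto (fun k => (z k : ℂ)) atTop (𝓝 s) := by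
    have := (Complex.continuous_ofReal.tendsto 0).comp hz_im
    refine (by simpa using (this.mul_const Complex.I).const_add (s : ℂ) : Tendsto _ _ _).congr
      fun k => ?_
    exact Complex.re_add_im (z k : ℂ)
  refine ⟨γ, hγ, (tendsto_iff_of_dist ?_).2 hz⟩
  refine squeeze_zero (fun _ => dist_nonneg) (fun k => (dist_coe_le _ _).trans ?_)
    (by simpa using hz_im.mul_const (Real.exp R - 1))
  gcongr
  exact hdist k

theorem CoboundedOrbit.exists_tendsto_minkowski_atBot (h : CoboundedOrbit G x)
    {n : MinkowskiSpace} (hn : minkowski n n < 0) :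
    ∃ γ : ℕ → ℍ ≃ᵢ ℍ, (∀ k, γ k ∈ G) ∧
      Tendsto (fun k => minkowski n (toHyperboloid (γ k x))) atTop atBot := by
  obtain ⟨s, hs⟩ := exists_quadratic_neg_of_minkowski_self_neg hn
  obtain ⟨γ, hγ, htendsto⟩ := h.exists_tendsto_coe s
  exact ⟨γ, hγ, tendsto_minkowski_toHyperboloid_atBot htendsto hs⟩

theorem CoboundedOrbit.exists_im_lt (h : CoboundedOrbit G x) (φ : ℍ ≃ᵢ ℍ) {ε : ℝ} (hε : 0 < ε) :
    ∃ g ∈ G, (φ (g x)).im < ε := by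
  obtain ⟨R, hR⟩ := h
  let p : ℍ := ⟨⟨0, ε / 2 * Real.exp (-R)⟩, by positivity⟩
  obtain ⟨g, hg, hdist⟩ := hR (φ.symm p)
  refine ⟨g, hg, ?_⟩
  calc (φ (g x)).im ≤ p.im * Real.exp (dist (φ (g x)) p) := im_le_im_mul_exp_dist _ _
    _ ≤ p.im * Real.exp R := by
      gcongr
      rwa [← φ.apply_symm_apply p, φ.dist_eq]
    _ = ε / 2 := by
      change ε / 2 * Real.exp (-R) * Real.exp R = ε / 2
      rw [mul_assoc, ← Real.exp_add, neg_add_cancel, Real.exp_zero, mul_one]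
    _ < ε := half_lt_self hε

end Orbits

section FixedBoundaryPoint

/-- All elements of `G` fix a common point of the circle at infinity, that is, a common isotropic
line of Minkowski space. -/
def FixesBoundaryPoint (G : Subgroup (ℍ ≃ᵢ ℍ)) : Prop :=
  ∃ v : MinkowskiSpace, v ≠ 0 ∧ minkowski v v = 0 ∧ ∀ g ∈ G, ∃ l : ℝ, lorentzMap g v = l • v

/-- In the coordinate `φ`, the isometry `g` is the similarity with multiplier `α` and translation
part `μ`; these are the isometries which fix the boundary point at infinity. -/
structure ActsAffinely (φ g : ℍ ≃ᵢ ℍ) (α μ : ℝ) : Prop where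
  re_apply : ∀ z, (φ (g z)).re = α * (φ z).re + μ
  im_apply : ∀ z, (φ (g z)).im = |α| * (φ z).im

variable {φ g h : ℍ ≃ᵢ ℍ} {α α' μ μ' : ℝ}

theorem im_specialLinearGroup_smul (σ : Matrix.SpecialLinearGroup (Fin 2) ℝ) (z : ℍ) :
    (σ • z).im = z.im / Complex.normSq (σ 1 0 * z + σ 1 1) := by
  rw [MulAction.compHom_smul_def, im_smul_eq_div_normSq]
  simp [denom]

theorem exists_lorentzMap_eq_of_minkowski_self_eq_zero {v : MinkowskiSpace} (hv : v ≠ 0)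
    (hv' : minkowski v v = 0) : ∃ φ : ℍ ≃ᵢ ℍ, ∃ c ≠ 0, lorentzMap φ v = (0, 0, c) := by
  obtain ⟨a, b, c⟩ := v
  simp only [minkowski_apply] at hv'
  by_cases ha : a = 0
  · have hb : b = 0 := by simpa [ha] using hv'
    subst ha hb
    refine ⟨1, c, fun hc => hv (by simp [hc]), eq_of_forall_minkowski_toHyperboloid_eq fun z => ?_⟩
    exact minkowski_lorentzMap_toHyperboloid 1 _ z
  have hc : c = b ^ 2 / (4 * a) := by field_simp; linarith
  let σ : Matrix.SpecialLinearGroup (Fin 2) ℝ := ⟨!![0, -1; 1, b / (2 * a)], by simp⟩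
  refine ⟨IsometryEquiv.constSMul σ, a, ha, eq_of_forall_minkowski_toHyperboloid_eq fun z => ?_⟩
  obtain ⟨z, rfl⟩ := (IsometryEquiv.constSMul σ).surjective z
  have him : (σ • z).im = z.im / ((z.re + b / (2 * a)) ^ 2 + z.im ^ 2) := by
    have hden : (σ 1 0 : ℂ) * z + σ 1 1 = ⟨z.re + b / (2 * a), z.im⟩ := by
      apply Complex.ext <;> simp [σ, -Complex.ofReal_div]
    rw [im_specialLinearGroup_smul, hden, Complex.normSq_mk, sq, sq]
  rw [minkowski_lorentzMap_toHyperboloid, minkowski_toHyperboloid, minkowski_toHyperboloid,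
    IsometryEquiv.constSMul_apply, him, hc]
  have := z.im_ne_zero
  have : (z.re + b / (2 * a)) ^ 2 + z.im ^ 2 ≠ 0 := by positivity
  simp only [zero_mul, zero_add, div_div_eq_mul_div]
  congr 1
  field_simp
  ring

theorem im_apply_eq_mul_of_lorentzMap_eq_smul {c l : ℝ} {v : MinkowskiSpace} (hc : c ≠ 0)
    (hφ : lorentzMap φ v = (0, 0, c)) (hg : lorentzMap g v = l • v) (z : ℍ) :
    (φ (g z)).im = l * (φ z).im := by
  have hv (z : ℍ) : minkowski v (toHyperboloid z) = c / (φ z).im := by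
    rw [← minkowski_lorentzMap_toHyperboloid φ, hφ, minkowski_toHyperboloid]
    simp
  have h := minkowski_lorentzMap_toHyperboloid g v z
  rw [hg, map_smul, LinearMap.smul_apply, smul_eq_mul, hv, hv] at h
  have := (φ z).im_ne_zero
  have := (φ (g z)).im_ne_zero
  field_simp at h
  linarith

theorem exists_actsAffinely {c l : ℝ} {v : MinkowskiSpace} (hc : c ≠ 0)
    (hφ : lorentzMap φ v = (0, 0, c)) (hg : lorentzMap g v = l • v) :
    ∃ α μ, ActsAffinely φ g α μ := by
  have him := im_apply_eq_mul_of_lorentzMap_eq_smul hc hφ hg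
  have hl : 0 < l := pos_of_mul_pos_left (him I ▸ (φ (g I)).im_pos) (φ I).im_pos.le
  obtain ⟨w, hw⟩ := lorentzMap_surjective φ (0, 1, 0)
  have hwv : minkowski w v = 0 := by
    rw [← minkowski_lorentzMap_lorentzMap φ, hw, hφ, minkowski_apply]; simp
  obtain ⟨⟨a, β, γ⟩, hw'⟩ : ∃ w', lorentzMap φ (lorentzMap g w) = w' := ⟨_, rfl⟩
  have ha : a = 0 := by
    have h : minkowski (a, β, γ) (l • (0, 0, c)) = 0 := by
      rw [← hw', ← hφ, ← map_smul, ← hg, minkowski_lorentzMap_lorentzMap,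
        minkowski_lorentzMap_lorentzMap, hwv]
    simpa [minkowski_apply, hl.ne', hc] using h
  have hβ : β * β = 1 := by
    have h : minkowski (a, β, γ) (a, β, γ) = minkowski (0, 1, 0) (0, 1, 0) := by
      rw [← hw', ← hw]
      simp only [minkowski_lorentzMap_lorentzMap]
    simpa [minkowski_apply, ha] using h
  refine ⟨β * l, -β * γ, fun z => ?_, fun z => ?_⟩
  · have h : minkowski (a, β, γ) (toHyperboloid (φ (g z))) =
        minkowski (0, 1, 0) (toHyperboloid (φ z)) := by
      rw [← hw', ← hw]
      simp only [minkowski_lorentzMap_toHyperboloid]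
    rw [minkowski_toHyperboloid, minkowski_toHyperboloid, him, ha] at h
    have := (φ z).im_ne_zero
    field_simp at h
    linear_combination β * h - (φ (g z)).re * hβ
  · rw [him, abs_mul, abs_of_pos hl, (abs_eq zero_le_one).2 (mul_self_eq_one_iff.1 hβ), one_mul]

theorem ActsAffinely.ne_zero (hg : ActsAffinely φ g α μ) : α ≠ 0 := by
  rintro rfl
  exact (φ (g I)).im_ne_zero (by simp [hg.im_apply])

theorem ActsAffinely.mul (hg : ActsAffinely φ g α μ) (hh : ActsAffinely φ h α' μ') :
    ActsAffinely φ (g * h) (α * α') (α * μ' + μ) where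
  re_apply z := by rw [IsometryEquiv.mul_apply, hg.re_apply, hh.re_apply]; ring
  im_apply z := by rw [IsometryEquiv.mul_apply, hg.im_apply, hh.im_apply, abs_mul, mul_assoc]

theorem ActsAffinely.inv (hg : ActsAffinely φ g α μ) :
    ActsAffinely φ g⁻¹ α⁻¹ (-α⁻¹ * μ) where
  re_apply z := by
    have := hg.re_apply (g⁻¹ z)
    rw [IsometryEquiv.apply_inv_self] at this
    rw [this]
    field_simp [hg.ne_zero]
    ring
  im_apply z := by
    have := hg.im_apply (g⁻¹ z)
    rw [IsometryEquiv.apply_inv_self] at this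
    rw [this, abs_inv, inv_mul_cancel_left₀ (abs_ne_zero.2 hg.ne_zero)]

theorem ActsAffinely.pow_of_center {s : ℝ} (hg : ActsAffinely φ g α ((1 - α) * s)) (k : ℕ) :
    ActsAffinely φ (g ^ k) (α ^ k) ((1 - α ^ k) * s) := by
  induction k with
  | zero => exact ⟨by simp, by simp⟩
  | succ k ih =>
    rw [pow_succ, pow_succ]
    convert ih.mul hg using 1
    ring

variable {G : Subgroup (ℍ ≃ᵢ ℍ)} {x : ℍ}

theorem DiscreteOrbit.finite_range (hd : DiscreteOrbit G x) {γ : ℕ → ℍ ≃ᵢ ℍ} (hγ : ∀ k, γ k ∈ G)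
    {r : ℝ} (hr : ∀ k, dist (γ k x) x ≤ r) : (Set.range fun k => γ k x).Finite :=
  (hd r).subset (Set.range_subset_iff.2 fun k => ⟨⟨γ k, hγ k, rfl⟩, hr k⟩)

/-- Conjugating `h` by powers of a contraction `g` moves the centre of `h` towards that of `g`,
which is impossible in a discrete orbit unless the centres agree. -/
theorem ActsAffinely.eq_of_discreteOrbit {s : ℝ} (hd : DiscreteOrbit G x) (hgG : g ∈ G)
    (hhG : h ∈ G) (hg : ActsAffinely φ g α ((1 - α) * s)) (hα : |α| < 1)
    (hh : ActsAffinely φ h α' μ) : μ = (1 - α') * s := by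
  by_contra hne
  set τ := μ - (1 - α') * s
  have hτ : τ ≠ 0 := sub_ne_zero.2 hne
  let γ (k : ℕ) := g ^ k * h * (g ^ k)⁻¹
  have hγ (k : ℕ) : ActsAffinely φ (γ k) α' ((1 - α') * s + α ^ k * τ) := by
    have := hg.pow_of_center k
    have hk : α ^ k ≠ 0 := this.ne_zero
    convert (this.mul hh).mul this.inv using 1
    · field_simp
    · simp only [τ]; field_simp; ring
  have hre (k : ℕ) : (φ (γ k x)).re = (φ (h x)).re + (α ^ k - 1) * τ := by
    rw [(hγ k).re_apply, hh.re_apply]; ring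
  have him (k : ℕ) : (φ (γ k x)).im = (φ (h x)).im := by
    rw [(hγ k).im_apply, hh.im_apply]
  have hinj : Function.Injective fun k => γ k x := fun i j hij => by
    have h₁ := (hre i).symm.trans ((congrArg (fun z => (φ z).re) hij).trans (hre j))
    have h₂ : α ^ i = α ^ j := by simpa [hτ] using h₁
    exact pow_right_injective₀ (abs_pos.2 hg.ne_zero) hα.ne (by simp only [← abs_pow, h₂])
  have hbdd (k : ℕ) : dist (γ k x) x ≤ 2 * |τ| / (φ (h x)).im + dist (h x) x := by
    refine (dist_triangle _ (h x) _).trans (add_le_add_left ?_ _)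
    rw [← φ.dist_eq]
    refine (dist_le_dist_coe_div_sqrt _ _).trans ?_
    rw [him, Real.sqrt_mul_self (φ (h x)).im_pos.le, Complex.dist_of_im_eq (him k), coe_re, coe_re,
      hre, Real.dist_eq, add_sub_cancel_left, abs_mul]
    gcongr
    calc |α ^ k - 1| ≤ |α| ^ k + 1 := by simpa [abs_pow] using abs_sub (α ^ k) 1
      _ ≤ 2 := by linarith [pow_le_one₀ (n := k) (abs_nonneg α) hα.le]
  exact Set.infinite_range_of_injective hinj <| hd.finite_range
    (fun k => G.mul_mem (G.mul_mem (G.pow_mem hgG k) hhG) (G.inv_mem (G.pow_mem hgG k))) hbdd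

theorem CoboundedOrbit.exists_not_actsAffinely (hc : CoboundedOrbit G x) (φ : ℍ ≃ᵢ ℍ) (s : ℝ) :
    ∃ g ∈ G, ∀ α, ¬ActsAffinely φ g α ((1 - α) * s) := by
  by_contra! hG
  obtain ⟨w, hw⟩ := lorentzMap_surjective φ (0, 1, -s)
  have hw_self : minkowski w w < 0 := by
    rw [← minkowski_lorentzMap_lorentzMap φ, hw, minkowski_apply]; simp
  obtain ⟨γ, hγ, htendsto⟩ := hc.exists_tendsto_minkowski_atBot hw_self
  obtain ⟨k, hk⟩ := (htendsto.eventually_lt_atBot (-(|(φ x).re - s| / (φ x).im))).exists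
  obtain ⟨α, hα⟩ := hG (γ k) (hγ k)
  rw [← minkowski_lorentzMap_toHyperboloid φ, hw, minkowski_toHyperboloid, hα.re_apply,
    hα.im_apply] at hk
  refine hk.not_ge (neg_le_of_abs_le (le_of_eq ?_))
  have h_re : 0 * ((α * (φ x).re + (1 - α) * s) ^ 2 + (|α| * (φ x).im) ^ 2) +
      1 * (α * (φ x).re + (1 - α) * s) + -s = α * ((φ x).re - s) := by ring
  have hα₀ : |α| ≠ 0 := abs_ne_zero.2 hα.ne_zero
  rw [h_re, abs_div, abs_mul, abs_mul, abs_abs, abs_of_pos (φ x).im_pos, mul_div_mul_left _ _ hα₀]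

theorem not_fixesBoundaryPoint (hc : CoboundedOrbit G x) (hd : DiscreteOrbit G x) :
    ¬FixesBoundaryPoint G := by
  rintro ⟨v, hv, hvv, hG⟩
  obtain ⟨φ, c, hc₀, hφ⟩ := exists_lorentzMap_eq_of_minkowski_self_eq_zero hv hvv
  have haff (g : ℍ ≃ᵢ ℍ) (hg : g ∈ G) : ∃ α μ, ActsAffinely φ g α μ := by
    obtain ⟨l, hl⟩ := hG g hg
    exact exists_actsAffinely hc₀ hφ hl
  obtain ⟨g, hg, him⟩ := hc.exists_im_lt φ (φ x).im_pos
  obtain ⟨α, μ, hgα⟩ := haff g hg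
  have hα : |α| < 1 := by
    rw [hgα.im_apply] at him
    exact (mul_lt_iff_lt_one_left (φ x).im_pos).1 him
  have hα' : 1 - α ≠ 0 := by linarith [le_abs_self α]
  rw [← mul_div_cancel₀ μ hα'] at hgα
  obtain ⟨h, hh, hnot⟩ := hc.exists_not_actsAffinely φ (μ / (1 - α))
  obtain ⟨β, ν, hhβ⟩ := haff h hh
  exact hnot β (hgα.eq_of_discreteOrbit hd hg hh hα hhβ ▸ hhβ)

end FixedBoundaryPoint

section Dynamics

variable {G : Subgroup (ℍ ≃ᵢ ℍ)} {x : ℍ} {n v : MinkowskiSpace}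

theorem CoboundedOrbit.exists_minkowski_lorentzMap_neg (hc : CoboundedOrbit G x)
    (hG : ¬FixesBoundaryPoint G) (hv : minkowski v v = 0)
    (hvx : 0 < minkowski v (toHyperboloid x)) (hn : minkowski n n < 0) :
    ∃ g ∈ G, minkowski n (lorentzMap g v) < 0 := by
  have hv₀ : v ≠ 0 := by rintro rfl; simp at hvx
  obtain ⟨g, hg, hgv⟩ : ∃ g ∈ G, ∀ l : ℝ, lorentzMap g v ≠ l • v := by
    by_contra! h
    exact hG ⟨v, hv₀, hv, h⟩
  have hgv_self : minkowski (lorentzMap g v) (lorentzMap g v) = 0 := by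
    rw [minkowski_lorentzMap_lorentzMap, hv]
  have hgvx : 0 < minkowski (lorentzMap g v) (toHyperboloid x) := by
    rw [← g.apply_inv_self x, minkowski_lorentzMap_toHyperboloid]
    exact minkowski_toHyperboloid_pos hv.ge hvx _
  have hpos : 0 < minkowski v (lorentzMap g v) := by
    by_contra! h
    obtain ⟨l, hl⟩ := exists_eq_smul_of_minkowski_nonpos hv.ge hgv_self.ge hvx hgvx h
    exact hgv l hl
  obtain ⟨c, hc₀, p, hp⟩ : ∃ c : ℝ, 0 < c ∧ ∃ p, v + lorentzMap g v = c • toHyperboloid p := by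
    refine exists_eq_smul_toHyperboloid (z := x) ?_ ?_
    · rw [minkowski_add_self, hv, hgv_self]; linarith
    · rw [map_add, LinearMap.add_apply]; exact add_pos hvx hgvx
  obtain ⟨γ, hγ, htendsto⟩ := (hc.of_point p).exists_tendsto_minkowski_atBot hn
  obtain ⟨k, hk⟩ := (htendsto.eventually_lt_atBot 0).exists
  have hsum : minkowski n (lorentzMap (γ k) v) + minkowski n (lorentzMap (γ k * g) v) < 0 := by
    rw [lorentzMap_mul, LinearMap.comp_apply, ← map_add, ← map_add, hp, map_smul, map_smul,
      lorentzMap_toHyperboloid]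
    exact mul_neg_of_pos_of_neg hc₀ hk
  by_cases h : minkowski n (lorentzMap (γ k) v) < 0
  · exact ⟨γ k, hγ k, h⟩
  · exact ⟨γ k * g, G.mul_mem (hγ k) hg, by linarith⟩

theorem CoboundedOrbit.exists_tendsto_smul_lorentzMap_inv (hc : CoboundedOrbit G x)
    (hn : minkowski n n < 0) :
    ∃ (γ : ℕ → ℍ ≃ᵢ ℍ) (t : ℕ → ℝ) (v : MinkowskiSpace), (∀ k, γ k ∈ G) ∧ (∀ k, 0 < t k) ∧
      Tendsto (fun k => t k • lorentzMap (γ k)⁻¹ n) atTop (𝓝 v) ∧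
      minkowski v v = 0 ∧ minkowski v (toHyperboloid x) = 1 := by
  have hn' : minkowski (-n) (-n) < 0 := by simpa using hn
  obtain ⟨γ, hγ, hlim⟩ := hc.exists_tendsto_minkowski_atBot hn'
  set T : ℕ → ℝ := fun k => minkowski n (toHyperboloid (γ k x))
  have hT : Tendsto T atTop atTop := by
    simpa [T, tendsto_neg_atBot_iff] using hlim
  set m : ℕ → MinkowskiSpace := fun k => (T k)⁻¹ • lorentzMap (γ k)⁻¹ n
  have hm_self (k : ℕ) : minkowski (m k) (m k) = (T k)⁻¹ ^ 2 * minkowski n n := by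
    rw [minkowski_smul_self, minkowski_lorentzMap_lorentzMap]
  have hm_x (k : ℕ) : minkowski (m k) (toHyperboloid x) = (T k)⁻¹ * T k := by
    rw [map_smul, LinearMap.smul_apply, smul_eq_mul, ← (γ k).inv_apply_self x,
      minkowski_lorentzMap_toHyperboloid]
  have hm_bdd : ∀ᶠ k in atTop, minkowski (m k) (toHyperboloid x) = 1 ∧
      minkowski n n ≤ minkowski (m k) (m k) := by
    filter_upwards [hT.eventually_ge_atTop 1] with k hk
    refine ⟨by rw [hm_x, inv_mul_cancel₀ (by linarith)], ?_⟩
    rw [hm_self]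
    have : (T k)⁻¹ ^ 2 ≤ 1 := pow_le_one₀ (by positivity) (inv_le_one_of_one_le₀ hk)
    nlinarith
  obtain ⟨v, -, φ, hφ, hv⟩ := tendsto_subseq_of_frequently_bounded
    (isBounded_setOf_minkowski_toHyperboloid_eq_one x (minkowski n n)) hm_bdd.frequently
  obtain ⟨N, hN⟩ := eventually_atTop.1 ((hT.comp hφ.tendsto_atTop).eventually_gt_atTop 0)
  refine ⟨fun k => γ (φ (k + N)), fun k => (T (φ (k + N)))⁻¹, v, fun k => hγ _,
    fun k => inv_pos.2 (hN _ (Nat.le_add_left N k)), hv.comp (tendsto_add_atTop_nat N), ?_, ?_⟩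
  · refine tendsto_nhds_unique ((continuous_minkowski_self.tendsto v).comp hv) ?_
    have : Tendsto (fun k => (T k)⁻¹ ^ 2 * minkowski n n) atTop (𝓝 0) := by
      simpa using ((tendsto_inv_atTop_zero.comp hT).pow 2).mul_const (minkowski n n)
    exact (this.congr fun k => (hm_self k).symm).comp hφ.tendsto_atTop
  · refine tendsto_nhds_unique (((continuous_minkowski_left _).tendsto v).comp hv) ?_
    exact tendsto_const_nhds.congr' ((hm_bdd.mono fun k hk => hk.1.symm).filter_mono
      hφ.tendsto_atTop)

theorem CoboundedOrbit.exists_image_subset (hc : CoboundedOrbit G x) (hG : ¬FixesBoundaryPoint G)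
    {H₁ H₂ : Set ℍ} (hH₁ : IsHalfplane H₁) (hH₂ : IsHalfplane H₂) : ∃ γ ∈ G, γ '' H₁ ⊆ H₂ := by
  obtain ⟨n₁, hn₁, rfl⟩ := hH₁.exists_eq_setOf_minkowski_nonneg
  obtain ⟨n₂, hn₂, rfl⟩ := hH₂.exists_eq_setOf_minkowski_nonneg
  obtain ⟨γ, t, v, hγ, ht, hlim, hv, hvx⟩ := hc.exists_tendsto_smul_lorentzMap_inv hn₂
  have hvx_pos : 0 < minkowski v (toHyperboloid x) := hvx ▸ one_pos
  obtain ⟨g, hg, hneg⟩ := hc.exists_minkowski_lorentzMap_neg hG hv hvx_pos hn₁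
  rw [minkowski_comm] at hneg
  have hgv : minkowski (lorentzMap g v) (lorentzMap g v) = 0 := by
    rw [minkowski_lorentzMap_lorentzMap, hv]
  have hgvx : 0 < minkowski (lorentzMap g v) (toHyperboloid (g x)) := by
    rwa [minkowski_lorentzMap_toHyperboloid]
  have hg_lim := (((lorentzMap g).continuous_of_finiteDimensional.tendsto v).comp hlim).eventually
    (eventually_forall_minkowski_toHyperboloid_pos hgv.ge hgvx hneg)
  obtain ⟨k, hk⟩ := hg_lim.exists
  refine ⟨γ k * g⁻¹, G.mul_mem (hγ k) (G.inv_mem hg), ?_⟩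
  rintro _ ⟨z, hz, rfl⟩
  have hz_pos := hk z hz
  rw [Function.comp_apply, map_smul, map_smul, LinearMap.smul_apply, smul_eq_mul,
    ← g.apply_inv_self z, minkowski_lorentzMap_toHyperboloid,
    ← (γ k).inv_apply_self (g⁻¹ z), minkowski_lorentzMap_toHyperboloid] at hz_pos
  exact (pos_of_mul_pos_right hz_pos (ht k).le).le

end Dynamics

section Segments

/-- The inversion `z ↦ -1 / (z - s)`, which sends the geodesic lines ending at `s` to vertical
lines. -/
noncomputable def inversionAt (s : ℝ) : ℍ ≃ᵢ ℍ :=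
  let σ : Matrix.SpecialLinearGroup (Fin 2) ℝ := ⟨!![0, -1; 1, -s], by simp⟩
  IsometryEquiv.constSMul σ

theorem coe_inversionAt (s : ℝ) (z : ℍ) : (inversionAt s z : ℂ) = -1 / (z - s) := by
  let σ : Matrix.SpecialLinearGroup (Fin 2) ℝ := ⟨!![0, -1; 1, -s], by simp⟩
  change UpperHalfPlane.coe (σ • z) = _
  rw [coe_specialLinearGroup_apply]
  simp [σ, sub_eq_add_neg]

theorem re_inversionAt (s : ℝ) (z : ℍ) :
    (inversionAt s z).re = (s - z.re) / ((z.re - s) ^ 2 + z.im ^ 2) := by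
  rw [← coe_re, coe_inversionAt]
  simp [Complex.div_re, Complex.normSq_apply, sq]

theorem exists_isometryEquiv_re_eq (x y : ℍ) : ∃ φ : ℍ ≃ᵢ ℍ, (φ x).re = (φ y).re := by
  by_cases h : x.re = y.re
  · exact ⟨1, h⟩
  have : y.re - x.re ≠ 0 := sub_ne_zero.2 (Ne.symm h)
  -- the half-circle through `x` and `y` has center `c` and radius `r`
  let c := (y.re ^ 2 + y.im ^ 2 - x.re ^ 2 - x.im ^ 2) / (2 * (y.re - x.re))
  have hc : (y.re - c) ^ 2 + y.im ^ 2 = (x.re - c) ^ 2 + x.im ^ 2 := by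
    have : c * (2 * (y.re - x.re)) = y.re ^ 2 + y.im ^ 2 - x.re ^ 2 - x.im ^ 2 :=
      div_mul_cancel₀ _ (by positivity)
    linarith
  have hpos : 0 < (x.re - c) ^ 2 + x.im ^ 2 := by have := x.im_pos; positivity
  obtain ⟨r, hr, hr_sq⟩ : ∃ r > 0, r ^ 2 = (x.re - c) ^ 2 + x.im ^ 2 :=
    ⟨_, Real.sqrt_pos.2 hpos, Real.sq_sqrt hpos.le⟩
  have re_eq (z : ℍ) (hz : (z.re - c) ^ 2 + z.im ^ 2 = r ^ 2) :
      (inversionAt (c - r) z).re = -1 / (2 * r) := by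
    have hz_pos : 0 < (z.re - (c - r)) ^ 2 + z.im ^ 2 := by have := z.im_pos; positivity
    rw [re_inversionAt, div_eq_div_iff hz_pos.ne' (by positivity)]
    linear_combination hz
  exact ⟨inversionAt (c - r), by rw [re_eq x hr_sq.symm, re_eq y (hc.trans hr_sq.symm)]⟩

theorem dist_mk_re_lt {z u : ℍ} (h : z.re ≠ u.re) :
    dist (⟨⟨u.re, z.im⟩, z.im_pos⟩ : ℍ) u < dist z u := by
  rw [← abs_of_nonneg (dist_nonneg (x := z) (y := u)), ← abs_of_nonneg (dist_nonneg (y := u)),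
    ← Real.cosh_lt_cosh, cosh_dist', cosh_dist']
  have := z.im_pos
  have := u.im_pos
  have : 0 < (z.re - u.re) ^ 2 := by
    have := sub_ne_zero.2 h
    positivity
  refine div_lt_div_of_pos_right ?_ (by positivity)
  simpa using this

theorem re_eq_of_mem_geodSegment {x y z : ℍ} (hxy : x.re = y.re) (hz : z ∈ geodSegment x y) :
    z.re = x.re := by
  by_contra hne
  have hx := dist_mk_re_lt hne
  have hy := dist_mk_re_lt (hxy ▸ hne)
  have htri := dist_triangle_left x y ⟨⟨x.re, z.im⟩, z.im_pos⟩
  simp only [← hxy] at hy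
  have hz : dist x z + dist z y = dist x y := hz
  rw [dist_comm x z] at hz
  linarith

theorem infinite_geodSegment_of_re_eq {x y : ℍ} (hre : x.re = y.re) (hxy : x ≠ y) :
    (geodSegment x y).Infinite := by
  have hlog : Real.log x.im ≠ Real.log y.im := fun h =>
    hxy (ext_re_im hre (Real.log_injOn_pos x.im_pos y.im_pos h))
  let F : ℝ → ℍ := fun u => ⟨⟨x.re, Real.exp u⟩, Real.exp_pos u⟩
  have hF : Isometry F := isometry_vertical_line x.re
  have hFx : F (Real.log x.im) = x := ext_re_im rfl (Real.exp_log x.im_pos)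
  have hFy : F (Real.log y.im) = y := ext_re_im hre (Real.exp_log y.im_pos)
  have hinf : (segment ℝ (Real.log x.im) (Real.log y.im)).Infinite := by
    rw [segment_eq_uIcc]
    exact Set.Icc_infinite (min_lt_max.2 hlog)
  refine (hinf.image hF.injective.injOn).mono ?_
  rintro _ ⟨u, hu, rfl⟩
  have hdist := dist_add_dist_of_mem_segment hu
  rwa [← hF.dist_eq, ← hF.dist_eq, ← hF.dist_eq, hFx, hFy] at hdist

theorem infinite_geodSegment {x y : ℍ} (hxy : x ≠ y) : (geodSegment x y).Infinite := by
  obtain ⟨φ, hφ⟩ := exists_isometryEquiv_re_eq x y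
  refine Set.Infinite.of_image φ ?_
  rw [image_geodSegment]
  exact infinite_geodSegment_of_re_eq hφ (φ.injective.ne hxy)

theorem left_mem_geodSegment (x y : ℍ) : x ∈ geodSegment x y := by simp [geodSegment]

theorem isClosed_geodSegment (x y : ℍ) : IsClosed (geodSegment x y) :=
  isClosed_eq (by fun_prop) (by fun_prop)

end Segments

section Separators

/-- A function that vanishes on `e`, is positive on one side of a geodesic line containing `e` and
negative on the other: both signs occur near every zero, and each of them on a connected part of
every ball. -/
structure IsSeparator (e : Set ℍ) (f : ℍ → ℝ) : Prop where
  eq_zero : ∀ z ∈ e, f z = 0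
  isPreconnected_pos : ∀ p r, IsPreconnected (Metric.ball p r ∩ {z | 0 < f z})
  isPreconnected_neg : ∀ p r, IsPreconnected (Metric.ball p r ∩ {z | f z < 0})
  mem_closure_pos : ∀ p, f p = 0 → p ∈ closure {z | 0 < f z}
  mem_closure_neg : ∀ p, f p = 0 → p ∈ closure {z | f z < 0}

theorem isPreconnected_ball_inter_re (p : ℍ) (r : ℝ) {C : Set ℝ} (hC : Convex ℝ C) :
    IsPreconnected (Metric.ball p r ∩ {z | z.re ∈ C}) := by
  have himage : ((↑) : ℍ → ℂ) '' (Metric.ball p r ∩ {z | z.re ∈ C}) =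
      ((↑) : ℍ → ℂ) '' Metric.ball p r ∩ Complex.reLm ⁻¹' C :=
    Set.image_inter_preimage _ _ (Complex.re ⁻¹' C)
  rw [← isEmbedding_coe.isInducing.isPreconnected_image, himage, image_coe_ball]
  exact ((convex_ball _ _).inter (hC.linear_preimage _)).isPreconnected

theorem tendsto_vadd_nhds (p : ℍ) : Tendsto (fun t : ℝ => t +ᵥ p) (𝓝 0) (𝓝 p) := by
  have hcont : Continuous fun t : ℝ => (t : ℂ) + p := by fun_prop
  rw [isEmbedding_coe.tendsto_nhds_iff]
  simpa [Function.comp_def] using hcont.tendsto 0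

theorem isSeparator_re_sub (a : ℝ) : IsSeparator {z | z.re = a} (fun z => z.re - a) where
  eq_zero _ hz := sub_eq_zero.2 hz
  isPreconnected_pos p r := by
    simpa using isPreconnected_ball_inter_re p r (convex_Ioi a)
  isPreconnected_neg p r := by
    simpa using isPreconnected_ball_inter_re p r (convex_Iio a)
  mem_closure_pos p hp := by
    refine mem_closure_of_tendsto (b := 𝓝[>] 0)
      ((tendsto_vadd_nhds p).mono_left nhdsWithin_le_nhds) ?_
    filter_upwards [self_mem_nhdsWithin] with t (ht : 0 < t)
    rwa [vadd_re, add_sub_assoc, hp, add_zero]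
  mem_closure_neg p hp := by
    refine mem_closure_of_tendsto (b := 𝓝[<] 0)
      ((tendsto_vadd_nhds p).mono_left nhdsWithin_le_nhds) ?_
    filter_upwards [self_mem_nhdsWithin] with t (ht : t < 0)
    rwa [vadd_re, add_sub_assoc, hp, add_zero]

theorem IsSeparator.comp_isometryEquiv {e : Set ℍ} {f : ℍ → ℝ} (hf : IsSeparator e f)
    (φ : ℍ ≃ᵢ ℍ) : IsSeparator (φ ⁻¹' e) (f ∘ φ) := by
  have hball (p : ℍ) (r : ℝ) (C : Set ℝ) : Metric.ball p r ∩ {z | (f ∘ φ) z ∈ C} =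
      φ.symm '' (Metric.ball (φ p) r ∩ {z | f z ∈ C}) := by
    change _ = φ.toEquiv.symm '' _
    rw [φ.toEquiv.symm.image_eq_preimage_symm, Set.preimage_inter]
    exact congrArg (· ∩ _) (by simp)
  have hcont (s : Set ℍ) : ContinuousOn φ.symm s := φ.symm.continuous.continuousOn
  refine ⟨fun z hz => hf.eq_zero _ hz, fun p r => ?_, fun p r => ?_, fun p hp => ?_, fun p hp => ?_⟩
  · exact hball p r (Set.Ioi 0) ▸ (hf.isPreconnected_pos _ _).image _ (hcont _)
  · exact hball p r (Set.Iio 0) ▸ (hf.isPreconnected_neg _ _).image _ (hcont _)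
  · exact (φ.toHomeomorph.preimage_closure _).subset (hf.mem_closure_pos _ hp)
  · exact (φ.toHomeomorph.preimage_closure _).subset (hf.mem_closure_neg _ hp)

theorem IsSeparator.mono {e e' : Set ℍ} {f : ℍ → ℝ} (hf : IsSeparator e f) (h : e' ⊆ e) :
    IsSeparator e' f :=
  { hf with eq_zero := fun z hz => hf.eq_zero z (h hz) }

theorem IsSeparator.exists_mem_ne_zero {e U : Set ℍ} {f : ℍ → ℝ} (hf : IsSeparator e f)
    (hU : IsOpen U) (hU' : U.Nonempty) : ∃ z ∈ U, f z ≠ 0 := by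
  by_contra! hzero
  obtain ⟨p, hp⟩ := hU'
  obtain ⟨z, hzU, hz⟩ := mem_closure_iff.1 (hf.mem_closure_pos p (hzero p hp)) U hU hp
  exact (show 0 < f z from hz).ne' (hzero z hzU)

theorem exists_isSeparator_geodSegment (x y : ℍ) : ∃ f, IsSeparator (geodSegment x y) f := by
  obtain ⟨φ, hφ⟩ := exists_isometryEquiv_re_eq x y
  refine ⟨_, ((isSeparator_re_sub (φ x).re).comp_isometryEquiv φ).mono fun z hz => ?_⟩
  exact re_eq_of_mem_geodSegment hφ (image_geodSegment φ x y ▸ Set.mem_image_of_mem φ hz)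

end Separators

theorem IsSimpleClosed.eq_of_mem_of_mem {n : ℕ} {v : ZMod n → ℍ} (hv : IsSimpleClosed v)
    {i j : ZMod n} {p : ℍ} (hi : p ∈ geodSegment (v i) (v (i + 1)))
    (hj : p ∈ geodSegment (v j) (v (j + 1))) (hp : p ∉ Set.range v) : j = i := by
  by_contra hji
  by_cases h₁ : j = i + 1
  · subst h₁
    exact hp ⟨i + 1, ((hv.consecutive i).subset ⟨hi, hj⟩).symm⟩
  by_cases h₂ : i = j + 1
  · subst h₂
    exact hp ⟨j + 1, ((hv.consecutive j).subset ⟨hj, hi⟩).symm⟩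
  exact Set.disjoint_left.1 (hv.nonconsecutive i j hji h₁ h₂) hi hj

namespace Polygon

variable {T : Polygon} {e : Set ℍ} {f : ℍ → ℝ} {p : ℍ}

theorem isClosed (T : Polygon) : IsClosed T.carrier := T.isCompact.isClosed

theorem side_subset_frontier (he : e ∈ T.sides) : e ⊆ frontier T.carrier := by
  obtain ⟨n, v, -, -, -, hS, hF⟩ := T.boundary
  obtain ⟨i, rfl⟩ := hS ▸ he
  exact hF ▸ Set.subset_iUnion (fun i => geodSegment (v i) (v (i + 1))) i

theorem exists_side_mem {x : ℍ} (hx : x ∈ T.vertices) : ∃ e ∈ T.sides, x ∈ e := by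
  obtain ⟨n, v, -, -, hV, hS, -⟩ := T.boundary
  obtain ⟨i, rfl⟩ := hV ▸ hx
  exact ⟨_, hS.symm.subset ⟨i, rfl⟩, left_mem_geodSegment _ _⟩

theorem vertices_subset_carrier (T : Polygon) : T.vertices ⊆ T.carrier := fun x hx => by
  obtain ⟨e, he, hxe⟩ := exists_side_mem hx
  exact T.isClosed.frontier_subset (side_subset_frontier he hxe)

theorem nonempty_vertices (T : Polygon) : T.vertices.Nonempty := by
  obtain ⟨n, v, -, -, hV, -, -⟩ := T.boundary
  exact hV ▸ Set.range_nonempty v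

theorem finite_vertices (T : Polygon) : T.vertices.Finite := by
  obtain ⟨n, v, hn, -, hV, -, -⟩ := T.boundary
  have : NeZero n := ⟨by omega⟩
  exact hV ▸ Set.finite_range v

theorem nonempty_interior (T : Polygon) : (interior T.carrier).Nonempty := by
  rw [← closure_nonempty_iff, T.closure_interior]
  exact T.nonempty_vertices.mono T.vertices_subset_carrier

theorem exists_eq_geodSegment (he : e ∈ T.sides) : ∃ x y, x ≠ y ∧ e = geodSegment x y := by
  obtain ⟨n, v, hn, hv, -, hS, -⟩ := T.boundary
  obtain ⟨i, rfl⟩ := hS ▸ he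
  have : Fact (1 < n) := ⟨by omega⟩
  exact ⟨_, _, hv.injective.ne (by simp), rfl⟩

theorem infinite_side (he : e ∈ T.sides) : e.Infinite := by
  obtain ⟨x, y, hxy, rfl⟩ := exists_eq_geodSegment he
  exact infinite_geodSegment hxy

theorem eventually_mem_side_of_mem_frontier (he : e ∈ T.sides) (hp : p ∈ e)
    (hpV : p ∉ T.vertices) : ∀ᶠ z in 𝓝 p, z ∈ frontier T.carrier → z ∈ e := by
  obtain ⟨n, v, hn, hv, hV, hS, hF⟩ := T.boundary
  have : NeZero n := ⟨by omega⟩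
  obtain ⟨i, rfl⟩ := hS ▸ he
  rw [hV] at hpV
  have hfar (j : ZMod n) (hj : j ≠ i) : ∀ᶠ z in 𝓝 p, z ∉ geodSegment (v j) (v (j + 1)) :=
    (isClosed_geodSegment _ _).isOpen_compl.mem_nhds fun hpj => hj (hv.eq_of_mem_of_mem hp hpj hpV)
  filter_upwards [eventually_all.2 fun j => eventually_imp_distrib_left.2 (hfar j)] with z hz hzF
  obtain ⟨j, hzj⟩ := Set.mem_iUnion.1 (hF ▸ hzF)
  by_cases hji : j = i
  · exact hji ▸ hzj
  · exact absurd hzj (hz j hji)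

theorem eventually_mem_interior_pos_or_neg (he : e ∈ T.sides) (hf : IsSeparator e f) (hp : p ∈ e)
    (hpV : p ∉ T.vertices) :
    (∀ᶠ z in 𝓝 p, 0 < f z → z ∈ interior T.carrier) ∨
      ∀ᶠ z in 𝓝 p, f z < 0 → z ∈ interior T.carrier := by
  obtain ⟨r, hr, hball⟩ :=
    Metric.eventually_nhds_iff_ball.1 (eventually_mem_side_of_mem_frontier he hp hpV)
  have hcover {z : ℍ} (hz : z ∈ Metric.ball p r) (hfz : f z ≠ 0) :
      z ∈ interior T.carrier ∪ T.carrierᶜ := by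
    by_contra h
    rw [Set.mem_union, not_or, Set.notMem_compl_iff] at h
    exact hfz (hf.eq_zero z (hball z hz (T.isClosed.frontier_eq ▸ ⟨h.2, h.1⟩)))
  have hdisj : Disjoint (interior T.carrier) T.carrierᶜ :=
    Set.disjoint_compl_right_iff_subset.2 interior_subset
  rcases (hf.isPreconnected_pos p r).subset_or_subset isOpen_interior T.isClosed.isOpen_compl
    hdisj fun z hz => hcover hz.1 (ne_of_gt hz.2) with hpos | hpos
  · exact .inl (Metric.eventually_nhds_iff_ball.2 ⟨r, hr, fun z hz hfz => hpos ⟨hz, hfz⟩⟩)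
  rcases (hf.isPreconnected_neg p r).subset_or_subset isOpen_interior T.isClosed.isOpen_compl
    hdisj fun z hz => hcover hz.1 (ne_of_lt hz.2) with hneg | hneg
  · exact .inr (Metric.eventually_nhds_iff_ball.2 ⟨r, hr, fun z hz hfz => hneg ⟨hz, hfz⟩⟩)
  exfalso
  have hp_closure : p ∈ closure (interior T.carrier) := by
    rw [T.closure_interior]
    exact T.isClosed.frontier_subset (side_subset_frontier he hp)
  obtain ⟨q, ⟨hq, hqT⟩, hfq⟩ := hf.exists_mem_ne_zero (Metric.isOpen_ball.inter isOpen_interior)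
    (mem_closure_iff.1 hp_closure _ Metric.isOpen_ball (Metric.mem_ball_self hr))
  rcases lt_or_gt_of_ne hfq with h | h
  · exact hneg ⟨hq, h⟩ (interior_subset hqT)
  · exact hpos ⟨hq, h⟩ (interior_subset hqT)

end Polygon

section LocalFiniteness

variable {𝒯 : Set Polygon}

theorem eq_of_eventually_mem_interior (hdisj : 𝒯.PairwiseDisjoint fun T => interior T.carrier)
    {T T' : Polygon} (hT : T ∈ 𝒯) (hT' : T' ∈ 𝒯) {s : Set ℍ} {p : ℍ} (hp : p ∈ closure s)
    (h : ∀ᶠ z in 𝓝 p, z ∈ s → z ∈ interior T.carrier)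
    (h' : ∀ᶠ z in 𝓝 p, z ∈ s → z ∈ interior T'.carrier) : T = T' := by
  obtain ⟨z, hzs, hz, hz'⟩ := ((mem_closure_iff_frequently.1 hp).and_eventually (h.and h')).exists
  exact hdisj.elim_set hT hT' z (hz hzs) (hz' hzs)

theorem eq_or_eq_or_eq_of_common_side (hdisj : 𝒯.PairwiseDisjoint fun T => interior T.carrier)
    {T₁ T₂ T₃ : Polygon} (h₁ : T₁ ∈ 𝒯) (h₂ : T₂ ∈ 𝒯) (h₃ : T₃ ∈ 𝒯) {e : Set ℍ}
    (he₁ : e ∈ T₁.sides) (he₂ : e ∈ T₂.sides) (he₃ : e ∈ T₃.sides) :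
    T₁ = T₂ ∨ T₁ = T₃ ∨ T₂ = T₃ := by
  obtain ⟨f, hf⟩ : ∃ f, IsSeparator e f := by
    obtain ⟨x, y, -, rfl⟩ := Polygon.exists_eq_geodSegment he₁
    exact exists_isSeparator_geodSegment x y
  obtain ⟨p, hp, hpV⟩ := (Polygon.infinite_side he₁).exists_notMem_finite
    ((T₁.finite_vertices.union T₂.finite_vertices).union T₃.finite_vertices)
  simp only [Set.mem_union, not_or] at hpV
  have hpos := hf.mem_closure_pos p (hf.eq_zero p hp)
  have hneg := hf.mem_closure_neg p (hf.eq_zero p hp)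
  rcases Polygon.eventually_mem_interior_pos_or_neg he₁ hf hp hpV.1.1 with c₁ | c₁ <;>
  rcases Polygon.eventually_mem_interior_pos_or_neg he₂ hf hp hpV.1.2 with c₂ | c₂ <;>
  rcases Polygon.eventually_mem_interior_pos_or_neg he₃ hf hp hpV.2 with c₃ | c₃
  all_goals
    first
    | exact .inl (eq_of_eventually_mem_interior hdisj h₁ h₂ ‹_› c₁ c₂)
    | exact .inr (.inl (eq_of_eventually_mem_interior hdisj h₁ h₃ ‹_› c₁ c₃))
    | exact .inr (.inr (eq_of_eventually_mem_interior hdisj h₂ h₃ ‹_› c₂ c₃))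

theorem finite_setOf_mem_sides (hdisj : 𝒯.PairwiseDisjoint fun T => interior T.carrier)
    (e : Set ℍ) : {T ∈ 𝒯 | e ∈ T.sides}.Finite := by
  by_contra hinf
  obtain ⟨s, hs, hcard⟩ := Set.Infinite.exists_subset_card_eq hinf 3
  obtain ⟨T₁, h₁, T₂, h₂, T₃, h₃, h₁₂, h₁₃, h₂₃⟩ := Finset.two_lt_card.1 (by omega : 2 < s.card)
  rcases eq_or_eq_or_eq_of_common_side hdisj (hs h₁).1 (hs h₂).1 (hs h₃).1 (hs h₁).2 (hs h₂).2
    (hs h₃).2 with h | h | h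
  exacts [h₁₂ h, h₁₃ h, h₂₃ h]

theorem finite_setOf_mem_vertices (hdisj : 𝒯.PairwiseDisjoint fun T => interior T.carrier)
    {x : ℍ} (hx : {e ∈ tilingEdges 𝒯 | x ∈ e}.Finite) : {T ∈ 𝒯 | x ∈ T.vertices}.Finite := by
  refine (hx.biUnion fun e _ => finite_setOf_mem_sides hdisj e).subset ?_
  rintro T ⟨hT, hxT⟩
  obtain ⟨e, he, hxe⟩ := Polygon.exists_side_mem hxT
  exact Set.mem_biUnion ⟨Set.mem_biUnion hT he, hxe⟩ ⟨hT, he⟩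

end LocalFiniteness

section Size

/-- The polygon has diameter at most `K` and contains a ball of radius `1 / (K + 1)` in its
interior: a two-sided size bound, monotone in `K`, that only finitely many disjoint polygons
meeting a given ball can satisfy. -/
def Polygon.HasSize (T : Polygon) (K : ℕ) : Prop :=
  (∀ z ∈ T.carrier, ∀ w ∈ T.carrier, dist z w ≤ K) ∧
    ∃ c, Metric.ball c (1 / ((K : ℝ) + 1)) ⊆ interior T.carrier

theorem Polygon.HasSize.mono {T : Polygon} {K L : ℕ} (h : T.HasSize K) (hKL : K ≤ L) :
    T.HasSize L := by
  have hKL : (K : ℝ) ≤ L := Nat.cast_le.2 hKL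
  refine ⟨fun z hz w hw => (h.1 z hz w hw).trans hKL, h.2.imp fun c hc => ?_⟩
  exact (Metric.ball_subset_ball (by gcongr)).trans hc

theorem Polygon.exists_hasSize (T : Polygon) : ∃ K, T.HasSize K := by
  obtain ⟨D, hD⟩ := Metric.isBounded_iff.1 T.isCompact.isBounded
  obtain ⟨c, hc⟩ := T.nonempty_interior
  obtain ⟨r, hr, hball⟩ := Metric.isOpen_iff.1 isOpen_interior c hc
  obtain ⟨K₁, hK₁⟩ := exists_nat_ge D
  obtain ⟨K₂, hK₂⟩ := exists_nat_one_div_lt hr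
  refine ⟨max K₁ K₂, fun z hz w hw => (hD hz hw).trans (hK₁.trans (by simp)), c, ?_⟩
  refine (Metric.ball_subset_ball (le_trans ?_ hK₂.le)).trans hball
  gcongr
  exact le_max_right _ _

theorem Polygon.HasSize.of_map {T : Polygon} {g : ℍ ≃ᵢ ℍ} {K : ℕ} (h : (T.map g).HasSize K) :
    T.HasSize K := by
  obtain ⟨hdiam, c, hc⟩ := h
  refine ⟨fun z hz w hw => ?_, g.symm c, ?_⟩
  · rw [← g.dist_eq]
    exact hdiam _ ⟨z, hz, rfl⟩ _ ⟨w, hw, rfl⟩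
  · have himage : interior (g '' T.carrier) = g '' interior T.carrier :=
      (g.toHomeomorph.image_interior T.carrier).symm
    rw [← g.preimage_ball, ← g.injective.preimage_image (interior T.carrier), ← himage]
    exact Set.preimage_mono hc

theorem finite_of_totallyBounded_image_of_dist_lt_imp_eq {ι X : Type*} [PseudoMetricSpace X]
    {s : Set ι} {c : ι → X} {r : ℝ} (hr : 0 < r) (hs : TotallyBounded (c '' s))
    (hsep : ∀ i ∈ s, ∀ j ∈ s, dist (c i) (c j) < r → i = j) : s.Finite := by
  obtain ⟨t, ht, hcover⟩ := Metric.totallyBounded_iff.1 hs (r / 2) (half_pos hr)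
  have hsub : s ⊆ ⋃ y ∈ t, {i ∈ s | c i ∈ Metric.ball y (r / 2)} := fun i hi => by
    obtain ⟨y, hy, hiy⟩ := Set.mem_iUnion₂.1 (hcover ⟨i, hi, rfl⟩)
    exact Set.mem_biUnion hy ⟨hi, hiy⟩
  refine (ht.biUnion fun y _ => Set.Subsingleton.finite ?_).subset hsub
  rintro i ⟨hi, hiy⟩ j ⟨hj, hjy⟩
  refine hsep i hi j hj ((dist_triangle_right _ _ y).trans_lt ?_)
  rw [← add_halves r]
  exact add_lt_add hiy hjy

variable {𝒯 : Set Polygon} {K : ℕ}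

theorem finite_setOf_inter_closedBall_nonempty
    (hdisj : 𝒯.PairwiseDisjoint fun T => interior T.carrier)
    (hK : ∀ T ∈ 𝒯, T.HasSize K) (x : ℍ) (ρ : ℝ) :
    {T ∈ 𝒯 | (T.carrier ∩ Metric.closedBall x ρ).Nonempty}.Finite := by
  have hr : (0 : ℝ) < 1 / ((K : ℝ) + 1) := by positivity
  choose! c hc using fun T hT => (hK T hT).2
  refine finite_of_totallyBounded_image_of_dist_lt_imp_eq (c := c) hr
    ((isCompact_closedBall x (K + ρ)).totallyBounded.subset ?_) ?_
  · rintro _ ⟨T, ⟨hT, z, hzT, hz⟩, rfl⟩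
    have hcT : c T ∈ T.carrier := interior_subset (hc T hT (Metric.mem_ball_self hr))
    exact (dist_triangle _ z _).trans (add_le_add ((hK T hT).1 _ hcT _ hzT) hz)
  · rintro T ⟨hT, -⟩ T' ⟨hT', -⟩ hdist
    exact hdisj.elim_set hT hT' (c T) (hc T hT (Metric.mem_ball_self hr)) (hc T' hT' hdist)

theorem finite_tilingVertices_inter_closedBall
    (hdisj : 𝒯.PairwiseDisjoint fun T => interior T.carrier)
    (hK : ∀ T ∈ 𝒯, T.HasSize K) (x : ℍ) (ρ : ℝ) :
    (tilingVertices 𝒯 ∩ Metric.closedBall x ρ).Finite := by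
  refine ((finite_setOf_inter_closedBall_nonempty hdisj hK x ρ).biUnion
    fun T _ => T.finite_vertices).subset ?_
  rintro y ⟨hy, hyx⟩
  obtain ⟨T, hT, hyT⟩ := Set.mem_iUnion₂.1 hy
  exact Set.mem_biUnion ⟨hT, y, T.vertices_subset_carrier hyT, hyx⟩ hyT

end Size

section GroupActions

variable {𝒯 : Set Polygon} {Γ : Subgroup (ℍ ≃ᵢ ℍ)} {F : Set ℍ}

theorem nonempty_tilingVertices (hcov : ⋃ T ∈ 𝒯, T.carrier = Set.univ) :
    (tilingVertices 𝒯).Nonempty := by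
  obtain ⟨T, hT, -⟩ := Set.mem_iUnion₂.1 (hcov.symm.subset (Set.mem_univ I))
  exact T.nonempty_vertices.mono (Set.subset_biUnion_of_mem (u := Polygon.vertices) hT)

theorem apply_mem_tilingVertices {g : ℍ ≃ᵢ ℍ} (hg : ∀ T ∈ 𝒯, T.map g ∈ 𝒯) {x : ℍ}
    (hx : x ∈ tilingVertices 𝒯) : g x ∈ tilingVertices 𝒯 := by
  obtain ⟨T, hT, hxT⟩ := Set.mem_iUnion₂.1 hx
  exact Set.mem_biUnion (hg T hT) ⟨x, hxT, rfl⟩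

theorem exists_forall_hasSize (hdisj : 𝒯.PairwiseDisjoint fun T => interior T.carrier)
    (hdeg : ∀ x ∈ tilingVertices 𝒯, {e ∈ tilingEdges 𝒯 | x ∈ e}.Finite)
    (hΓ : ∀ g ∈ Γ, ∀ T ∈ 𝒯, T.map g ∈ 𝒯) (hF : F.Finite)
    (horbit : ∀ y ∈ tilingVertices 𝒯, ∃ x ∈ F, ∃ g ∈ Γ, g x = y) :
    ∃ K, ∀ T ∈ 𝒯, T.HasSize K := by
  choose K hK using Polygon.exists_hasSize
  have hfinite : (⋃ x ∈ F ∩ tilingVertices 𝒯, {T ∈ 𝒯 | x ∈ T.vertices}).Finite :=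
    (hF.inter_of_left _).biUnion fun x hx => finite_setOf_mem_vertices hdisj (hdeg x hx.2)
  obtain ⟨L, hL⟩ := (hfinite.image K).bddAbove
  refine ⟨L, fun T hT => ?_⟩
  obtain ⟨y, hy⟩ := T.nonempty_vertices
  obtain ⟨x, hx, g, hg, rfl⟩ := horbit y (Set.mem_biUnion hT hy)
  have hgT : T.map g⁻¹ ∈ 𝒯 := hΓ _ (Γ.inv_mem hg) T hT
  have hxT : x ∈ (T.map g⁻¹).vertices := ⟨g x, hy, g.symm_apply_apply x⟩
  have hL_ge : K (T.map g⁻¹) ≤ L :=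
    hL ⟨_, Set.mem_biUnion ⟨hx, Set.mem_biUnion hgT hxT⟩ ⟨hgT, hxT⟩, rfl⟩
  exact ((hK _).mono hL_ge).of_map

theorem coboundedOrbit_of_forall_hasSize (hcov : ⋃ T ∈ 𝒯, T.carrier = Set.univ) {K : ℕ}
    (hK : ∀ T ∈ 𝒯, T.HasSize K) (hF : F.Finite)
    (horbit : ∀ y ∈ tilingVertices 𝒯, ∃ x ∈ F, ∃ g ∈ Γ, g x = y) (x : ℍ) :
    CoboundedOrbit Γ x := by
  obtain ⟨M, hM⟩ := (hF.image (dist x)).bddAbove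
  refine ⟨M + K, fun z => ?_⟩
  obtain ⟨T, hT, hz⟩ := Set.mem_iUnion₂.1 (hcov.symm.subset (Set.mem_univ z))
  obtain ⟨y, hy⟩ := T.nonempty_vertices
  obtain ⟨w, hw, g, hg, rfl⟩ := horbit y (Set.mem_biUnion hT hy)
  refine ⟨g, hg, (dist_triangle _ (g w) _).trans (add_le_add ?_ ?_)⟩
  · rw [g.dist_eq]
    exact hM ⟨w, hw, rfl⟩
  · exact (hK T hT).1 _ (T.vertices_subset_carrier hy) _ hz

theorem CoboundedOrbit.orientationPreservingSubgroup {x : ℍ} (h : CoboundedOrbit Γ x) :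
    CoboundedOrbit (orientationPreservingSubgroup Γ) x := by
  obtain ⟨R, hR⟩ := h
  obtain ⟨s, hs⟩ := exists_mul_mem_orientationPreservingSubgroup Γ
  refine ⟨dist (s x) x + R, fun z => ?_⟩
  obtain ⟨g, hg, hgz⟩ := hR z
  rcases hs g hg with hg' | hg'
  · exact ⟨g, hg', hgz.trans (le_add_of_nonneg_left dist_nonneg)⟩
  · refine ⟨g * s, hg', (dist_triangle _ (g x) _).trans (add_le_add ?_ hgz)⟩
    rw [IsometryEquiv.mul_apply, g.dist_eq]

theorem discreteOrbit_of_forall_hasSize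
    (hdisj : 𝒯.PairwiseDisjoint fun T => interior T.carrier) {K : ℕ}
    (hK : ∀ T ∈ 𝒯, T.HasSize K) (hΓ : ∀ g ∈ Γ, ∀ T ∈ 𝒯, T.map g ∈ 𝒯) {x : ℍ}
    (hx : x ∈ tilingVertices 𝒯) : DiscreteOrbit Γ x := fun r => by
  refine (finite_tilingVertices_inter_closedBall hdisj hK x r).subset
    (Set.inter_subset_inter_left _ ?_)
  rintro _ ⟨g, hg, rfl⟩
  exact apply_mem_tilingVertices (hΓ g hg) hx

end GroupActions

end HypTiling

theorem mainTheorem6_general (𝒯 : Set HypTiling.Polygon)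
    (hcov : ⋃ T ∈ 𝒯, T.carrier = Set.univ)
    (hdisj : 𝒯.PairwiseDisjoint fun T => interior T.carrier)
    (hdeg : ∀ x ∈ HypTiling.tilingVertices 𝒯, {e ∈ HypTiling.tilingEdges 𝒯 | x ∈ e}.Finite)
    (Γ : Subgroup (ℍ ≃ᵢ ℍ)) (hΓ : ∀ g ∈ Γ, ∀ T ∈ 𝒯, T.map g ∈ 𝒯)
    {F : Set ℍ} (hF : F.Finite)
    (horbit : ∀ y ∈ HypTiling.tilingVertices 𝒯, ∃ x ∈ F, ∃ g ∈ Γ, g x = y)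
    {H₁ H₂ : Set ℍ} (hH₁ : HypTiling.IsHalfplane H₁) (hH₂ : HypTiling.IsHalfplane H₂) :
    ∃ γ ∈ HypTiling.orientationPreservingSubgroup Γ, γ '' H₁ ⊆ H₂ := by
  obtain ⟨x, hx⟩ := HypTiling.nonempty_tilingVertices hcov
  obtain ⟨K, hK⟩ := HypTiling.exists_forall_hasSize hdisj hdeg hΓ hF horbit
  have hcobounded : HypTiling.CoboundedOrbit (HypTiling.orientationPreservingSubgroup Γ) x :=
    (HypTiling.coboundedOrbit_of_forall_hasSize hcov hK hF horbit x).orientationPreservingSubgroup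
  have hdiscrete : HypTiling.DiscreteOrbit (HypTiling.orientationPreservingSubgroup Γ) x :=
    (HypTiling.discreteOrbit_of_forall_hasSize hdisj hK hΓ hx).mono fun g hg => hg.1
  exact hcobounded.exists_image_subset (HypTiling.not_fixesBoundaryPoint hcobounded hdiscrete)
    hH₁ hH₂

theorem mainTheorem6 (𝒯 : Set HypTiling.Polygon) (h𝒯 : HypTiling.IsTiling 𝒯)
    (Γ : Subgroup (UpperHalfPlane ≃ᵢ UpperHalfPlane))
    (hΓ : HypTiling.ActsVertexTransitively Γ 𝒯)
    (H₁ H₂ : Set UpperHalfPlane)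
    (hH₁ : HypTiling.IsHalfplane H₁) (hH₂ : HypTiling.IsHalfplane H₂) :
    ∃ γ ∈ HypTiling.orientationPreservingSubgroup Γ, γ '' H₁ ⊆ H₂ := by
  obtain ⟨x, hx⟩ := HypTiling.nonempty_tilingVertices h𝒯.covers
  exact mainTheorem6_general 𝒯 h𝒯.covers h𝒯.disjoint_interior h𝒯.finite_degree Γ hΓ.preserves
    (Set.finite_singleton x) (fun y hy => ⟨x, rfl, hΓ.transitive x hx y hy⟩) hH₁ hH₂
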